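/- **Problem.** Let $\mathcal X\subset\mathbb R^{n_1}$, $\mathcal Y\subset\mathbb R^{n_2}$ be closed and convex, $A\in\mathbb R^{n\times n_1}$, $B\in\mathbb R^{n\times n_2}$, $b\in\mathbb R^n$. Let $f=\frac1N\sum_{j=1}^N f_j$, where each $f_j$ is real-valued, convex on $\mathcal X$ and differentiable at every point of $\mathcal X$, and let $g:\mathcal Y\to\mathbb R\cup\{+\infty\}$ be proper, convex and Borel measurable. Consider $\min\{f(x)+g(y): x\in\mathcal X,\ y\in\mathcal Y,\ Ax+By=b\}$, and put $F(w)=f(x)+g(y)$ for $w=(x,y,\lambda)$, $\mathcal L(x,y,\lambda)=f(x)+g(y)-\lambda^{\sf T}(Ax+By-b)$ and $\mathcal L_\beta=\mathcal L+\frac\beta2\|Ax+By-b\|^2$. Let $\Omega^*$ be the set of saddle points of $\mathcal L$ on $\mathcal X\times\mathcal Y\times\mathbb R^n$, i.e. of $w^*=(x^*,y^*,\lambda^*)$ in this set with $\mathcal L(x^*,y^*,\lambda)\le\mathcal L(x^*,y^*,\lambda^*)\le\mathcal L(x,y,\lambda^*)$ for all $(x,y,\lambda)$ in it. Write $\|v\|_G^2=v^{\sf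 T}Gv$. **Parameters.** Let $\beta>0$, let $\mathcal H\succ0$ and $L\succeq0$ be symmetric matrices, and let $(\tau,s)\in\Delta=\{(\tau,s):\tau+s>0,\ \tau\le1,\ -\tau^2-s^2-\tau s+\tau+s+1\ge0\}$. Let $\nu>0$ satisfy $\|\nabla f_j(x_1)-\nabla f_j(x_2)\|_{\mathcal H^{-1}}\le\nu\|x_1-x_2\|_{\mathcal H}$ for all $x_1,x_2\in\mathcal X$ and all $j$. For constants $c_1,c_2,c_3>0$, $\varrho\ge1$ and an integer $m>0$ let, for $k=0,1,\dots$, $$m_k=\max\{\lceil c_3k^{\varrho}\rceil,m\},\qquad \eta_k=\min\Big\{\frac{c_1}{m_k(m_k+1)},c_2\Big\}.$$ **Algorithm (SAS-ADMM).** Start from a deterministic $(x^0,y^0,\lambda^0)\in\mathcal X\times\mathcal Y\times\mathbb R^n$ with $\breve x^0=x^0$. For $k=0,1,\dots$ choose a symmetric matrix $\mathcal M_k$ (it may depend on the past of the run) with $\mathcal D_k:=\mathcal M_k-\beta A^{\sf T}A\succeq0$ and set $h^k=-A^{\sf T}[\lambda^k-\beta(Ax^k+By^k-b)]$. Starting from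 $x_1=x^k$, $\breve x_1=\breve x^k$, do for $t=1,\dots,m_k$: with $\beta_t=\frac2{t+1}$, $\gamma_t=\frac2{t\eta_k}$, $\hat x_t=\beta_t\breve x_t+(1-\beta_t)x_t$ and $d_t=\nabla f_{\xi_t}(\hat x_t)+e_t$, $$\breve x_{t+1}=\arg\min_{x\in\mathcal X}\Big\{\langle d_t+h^k,x\rangle+\tfrac{\gamma_t}2\|x-\breve x_t\|_{\mathcal H}^2+\tfrac12\|x-x^k\|_{\mathcal M_k}^2\Big\},\qquad x_{t+1}=\beta_t\breve x_{t+1}+(1-\beta_t)x_t .$$ Here $\xi_t$ is uniform on $\{1,\dots,N\}$ and independent of everything that happened before step $t$, and $e_t$ is an integrable random vector with conditional mean zero given everything that happened before step $t$ (it may depend on $\xi_t$ and on the past). Put $(x^{k+1},\breve x^{k+1})=(x_{m_k+1},\breve x_{m_k+1})$ and $$\lambda^{k+\frac12}=\lambda^k-\tau\beta(Ax^{k+1}+By^k-b),\quad y^{k+1}\in\arg\min_{y\in\mathcal Y}\Big\{\mathcal L_\beta(x^{k+1},y,\lambda^{k+\frac12})+\tfrac12\|y-y^k\|_L^2\Big\},\quad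 \lambda^{k+1}=\lambda^{k+\frac12}-s\beta(Ax^{k+1}+By^{k+1}-b).$$ All iterates are random variables determined without looking into the future. Let $\delta_t=\nabla f(\hat x_t)-d_t$ in each inner iteration. **Theorem.** Let $\kappa\ge1$ be an integer such that for all $k\ge\kappa$: $\eta_k\le\frac1{2\nu}$; $\mathcal D_k\succeq\mathcal D_{k+1}$; and $\mathbb E\|\delta_t\|_{\mathcal H^{-1}}^2\le\sigma^2$ for all inner steps $t=1,\dots,m_k$ of outer iteration $k$, where $\sigma>0$ is a constant. For $k<\kappa$ let the $\delta_t$ have finite second moments, and, in case $\mathcal M_\kappa$ is random, let it be bounded. For $T\ge1$ let $$x_T=\frac1{T+1}\sum_{k=\kappa}^{\kappa+T}x^{k+1},\qquad y_T=\frac1{T+1}\sum_{k=\kappa}^{\kappa+T}y^{k+1},\qquad F(w_T)=f(x_T)+g(y_T).$$ Then for every $w^*\in\Omega^*$ the values $F(w^*)$ and $F(w_T)$ are finite, $F(w_T)$ and $\|Ax_T+By_T-b\|$ are integrable, and, as $T\to\infty$, both $$\big|\mathbb E[F(w_T)-F(w^*)]\big|\qquad\text{and}\qquad\mathbb E\|Ax_T+By_T-b\|$$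 are $\mathcal O(1/T)$ if $\varrho>1$, and $\mathcal O(T^{-1}\log T)$ if $\varrho=1$. -/

import Mathlib

open MeasureTheory ProbabilityTheory Filter Asymptotics
open scoped Matrix

namespace SASADMM

noncomputable section

/-- `ℝⁿ` with the Euclidean norm. -/
abbrev Vec (n : ℕ) : Type := EuclideanSpace ℝ (Fin n)

/-- The product `G v` of a matrix and a column vector. -/
def act {p q : ℕ} (G : Matrix (Fin p) (Fin q) ℝ) (v : Vec q) : Vec p :=
  Matrix.toEuclideanLin G v

/-- The quadratic form `‖v‖_G² = vᵀ G v`. -/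
def sqNormW {q : ℕ} (G : Matrix (Fin q) (Fin q) ℝ) (v : Vec q) : ℝ :=
  inner ℝ v (act G v)

/-- The weighted (semi)norm `‖v‖_G = √(vᵀ G v)`, for positive semidefinite `G`. -/
def normW {q : ℕ} (G : Matrix (Fin q) (Fin q) ℝ) (v : Vec q) : ℝ :=
  Real.sqrt (sqNormW G v)

/-- The data of `min { f(x) + g(y) | x ∈ X, y ∈ Y, A x + B y = b }` with
`f = (1/N) ∑ⱼ fⱼ` and `g : Y → ℝ ∪ {+∞}`. -/
structure Problem (n n₁ n₂ N : ℕ) where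
  X : Set (Vec n₁)
  Y : Set (Vec n₂)
  fj : Fin N → Vec n₁ → ℝ
  g : Vec n₂ → EReal
  A : Matrix (Fin n) (Fin n₁) ℝ
  B : Matrix (Fin n) (Fin n₂) ℝ
  b : Vec n

namespace Problem

variable {n n₁ n₂ N : ℕ} (P : Problem n n₁ n₂ N)

/-- The average `f = (1/N) ∑ⱼ fⱼ`. -/
def f (x : Vec n₁) : ℝ := (1 / (N : ℝ)) * ∑ j, P.fj j x

/-- The constraint residual `A x + B y - b`. -/
def resid (x : Vec n₁) (y : Vec n₂) : Vec n := act P.A x + act P.B y - P.b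

/-- The objective `F(w) = f(x) + g(y)`, with values in `ℝ ∪ {+∞}`. -/
def F (x : Vec n₁) (y : Vec n₂) : EReal := (P.f x : EReal) + P.g y

/-- The Lagrangian `f(x) + g(y) - λᵀ (A x + B y - b)`. -/
def lagr (x : Vec n₁) (y : Vec n₂) (lam : Vec n) : EReal :=
  P.F x y + ((-inner ℝ lam (P.resid x y) : ℝ) : EReal)

/-- The augmented Lagrangian. -/
def augLagr (β : ℝ) (x : Vec n₁) (y : Vec n₂) (lam : Vec n) : EReal :=
  P.lagr x y lam + ((β / 2 * ‖P.resid x y‖ ^ 2 : ℝ) : EReal)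

/-- `(x*, y*, λ*) ∈ X × Y × ℝⁿ` is a saddle point of the Lagrangian. -/
structure IsSaddlePoint (xs : Vec n₁) (ys : Vec n₂) (ls : Vec n) : Prop where
  mem_X : xs ∈ P.X
  mem_Y : ys ∈ P.Y
  le_left : ∀ lam : Vec n, P.lagr xs ys lam ≤ P.lagr xs ys ls
  le_right : ∀ x ∈ P.X, ∀ y ∈ P.Y, P.lagr xs ys ls ≤ P.lagr x y ls

/-- The standing assumptions on the problem: `X`, `Y` closed and convex; every `fⱼ` convex on `X`
and differentiable at the points of `X`; `g` proper and convex on `Y` with values in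
`ℝ ∪ {+∞}` (convexity as convexity of the epigraph), and Borel measurable on `Y`. -/
structure Standing : Prop where
  closed_X : IsClosed P.X
  convex_X : Convex ℝ P.X
  closed_Y : IsClosed P.Y
  convex_Y : Convex ℝ P.Y
  convex_f : ∀ j, ConvexOn ℝ P.X (P.fj j)
  diff_f : ∀ j, ∀ x ∈ P.X, DifferentiableAt ℝ (P.fj j) x
  g_ne_bot : ∀ y ∈ P.Y, P.g y ≠ ⊥
  g_proper : ∃ y ∈ P.Y, P.g y ≠ ⊤
  convex_g : Convex ℝ {p : Vec n₂ × ℝ | p.1 ∈ P.Y ∧ P.g p.1 ≤ (p.2 : EReal)}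
  meas_g : Measurable (fun y : P.Y => P.g y)

/-- `‖∇fⱼ(x₁) - ∇fⱼ(x₂)‖_{H⁻¹} ≤ ν ‖x₁ - x₂‖_H` on `X`, for all `j`. -/
def GradLipschitz (H : Matrix (Fin n₁) (Fin n₁) ℝ) (ν : ℝ) : Prop :=
  ∀ j, ∀ x₁ ∈ P.X, ∀ x₂ ∈ P.X,
    normW H⁻¹ (gradient (P.fj j) x₁ - gradient (P.fj j) x₂) ≤ ν * normW H (x₁ - x₂)

end Problem

/-- The stepsize region `Δ`. -/
def Delta : Set (ℝ × ℝ) :=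
  {p | 0 < p.1 + p.2 ∧ p.1 ≤ 1 ∧
    0 ≤ -p.1 ^ 2 - p.2 ^ 2 - p.1 * p.2 + p.1 + p.2 + 1}

/-- The parameters of the algorithm: penalty `β`, dual stepsizes `τ, s`, proximal matrices `H, L`,
inner iteration counts `m_k` and inner stepsizes `η_k`. -/
structure Params (n₁ n₂ : ℕ) where
  β : ℝ
  τ : ℝ
  s : ℝ
  H : Matrix (Fin n₁) (Fin n₁) ℝ
  L : Matrix (Fin n₂) (Fin n₂) ℝ
  m : ℕ → ℕ
  η : ℕ → ℝ

/-- The random variables appearing in a run. Outer iterates carry the index `k = 0, 1, …`: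
`x k`, `xb k` (for `x̆ᵏ`), `y k`, `lam k`, `lamHalf k` (for `λ^{k+1/2}`) and the matrix `M k`.
Inner quantities of the `k`-th call of the subroutine carry the indices `k` and `t = 1, 2, …`:
`xin k t` (for `x_t`), `xbin k t` (for `x̆_t`), the sampled index `ξ k t` and the random vector
`e k t`. -/
structure Trajectory (n n₁ n₂ N : ℕ) (Ω : Type*) where
  x : ℕ → Ω → Vec n₁
  xb : ℕ → Ω → Vec n₁
  y : ℕ → Ω → Vec n₂
  lam : ℕ → Ω → Vec n
  lamHalf : ℕ → Ω → Vec n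
  M : ℕ → Ω → Matrix (Fin n₁) (Fin n₁) ℝ
  xin : ℕ → ℕ → Ω → Vec n₁
  xbin : ℕ → ℕ → Ω → Vec n₁
  ξ : ℕ → ℕ → Ω → Fin N
  e : ℕ → ℕ → Ω → Vec n₁

namespace Trajectory

variable {n n₁ n₂ N : ℕ} {Ω : Type*} (Z : Trajectory n n₁ n₂ N Ω)

/-- `x̂_t = β_t x̆_t + (1 - β_t) x_t` with `β_t = 2 / (t + 1)`. -/
def xhat (k t : ℕ) (ω : Ω) : Vec n₁ :=
  (2 / ((t : ℝ) + 1)) • Z.xbin k t ω + (1 - 2 / ((t : ℝ) + 1)) • Z.xin k t ω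

/-- `d_t = ∇f_{ξ_t}(x̂_t) + e_t`. -/
def d (P : Problem n n₁ n₂ N) (k t : ℕ) (ω : Ω) : Vec n₁ :=
  gradient (P.fj (Z.ξ k t ω)) (Z.xhat k t ω) + Z.e k t ω

/-- `δ_t = ∇f(x̂_t) - d_t`. -/
def δ (P : Problem n n₁ n₂ N) (k t : ℕ) (ω : Ω) : Vec n₁ :=
  gradient P.f (Z.xhat k t ω) - Z.d P k t ω

/-- `hᵏ = -Aᵀ [λᵏ - β (A xᵏ + B yᵏ - b)]`. -/
def h (P : Problem n n₁ n₂ N) (S : Params n₁ n₂) (k : ℕ) (ω : Ω) : Vec n₁ :=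
  -act P.Aᵀ (Z.lam k ω - S.β • P.resid (Z.x k ω) (Z.y k ω))

/-- `D_k = M_k - β Aᵀ A`. -/
def D (P : Problem n n₁ n₂ N) (S : Params n₁ n₂) (k : ℕ) (ω : Ω) :
    Matrix (Fin n₁) (Fin n₁) ℝ :=
  Z.M k ω - S.β • (P.Aᵀ * P.A)

/-- The objective of the subproblem that defines `x̆_{t+1}`, with `γ_t = 2 / (t η_k)`. -/
def xObj (P : Problem n n₁ n₂ N) (S : Params n₁ n₂) (k t : ℕ) (ω : Ω) (x : Vec n₁) : ℝ :=
  inner ℝ (Z.d P k t ω + Z.h P S k ω) x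
    + (2 / ((t : ℝ) * S.η k)) / 2 * sqNormW S.H (x - Z.xbin k t ω)
    + 1 / 2 * sqNormW (Z.M k ω) (x - Z.x k ω)

/-- The objective of the subproblem that defines `y^{k+1}`. -/
def yObj (P : Problem n n₁ n₂ N) (S : Params n₁ n₂) (k : ℕ) (ω : Ω) (y : Vec n₂) : EReal :=
  P.augLagr S.β (Z.x (k + 1) ω) y (Z.lamHalf k ω)
    + ((1 / 2 * sqNormW S.L (y - Z.y k ω) : ℝ) : EReal)

/-- The update rules of the algorithm, along one outcome `ω`. -/
structure Updates (P : Problem n n₁ n₂ N) (S : Params n₁ n₂) (ω : Ω) : Prop where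
  xb_zero : Z.xb 0 ω = Z.x 0 ω
  D_psd : ∀ k, (Z.D P S k ω).PosSemidef
  xin_one : ∀ k, Z.xin k 1 ω = Z.x k ω
  xbin_one : ∀ k, Z.xbin k 1 ω = Z.xb k ω
  xbin_succ : ∀ k, ∀ t ∈ Finset.Icc 1 (S.m k),
    Z.xbin k (t + 1) ω ∈ P.X ∧ IsMinOn (Z.xObj P S k t ω) P.X (Z.xbin k (t + 1) ω)
  xin_succ : ∀ k, ∀ t ∈ Finset.Icc 1 (S.m k),
    Z.xin k (t + 1) ω = (2 / ((t : ℝ) + 1)) • Z.xbin k (t + 1) ω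
      + (1 - 2 / ((t : ℝ) + 1)) • Z.xin k t ω
  x_succ : ∀ k, Z.x (k + 1) ω = Z.xin k (S.m k + 1) ω
  xb_succ : ∀ k, Z.xb (k + 1) ω = Z.xbin k (S.m k + 1) ω
  lamHalf_eq : ∀ k, Z.lamHalf k ω
    = Z.lam k ω - (S.τ * S.β) • P.resid (Z.x (k + 1) ω) (Z.y k ω)
  y_succ : ∀ k, Z.y (k + 1) ω ∈ P.Y ∧ IsMinOn (Z.yObj P S k ω) P.Y (Z.y (k + 1) ω)
  lam_succ : ∀ k, Z.lam (k + 1) ω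
    = Z.lamHalf k ω - (S.s * S.β) • P.resid (Z.x (k + 1) ω) (Z.y (k + 1) ω)

/-- The probabilistic structure of a run. `𝓖 (k, t)` (lexicographically ordered indices) is the
information available after the first `t` inner steps of outer iteration `k`; in particular
`𝓖 (k, 0)` is what is known when outer iteration `k` starts. Iterates and matrices are
non-anticipating; `ξ_t` is uniform on the `N` indices and independent of the past; `e_t` is
integrable with mean zero given the past (it may depend on `ξ_t` and on the past). -/
structure Sampling [MeasurableSpace Ω] (S : Params n₁ n₂) (μ : Measure Ω)
    (𝓖 : Filtration (ℕ ×ₗ ℕ) (inferInstance : MeasurableSpace Ω)) : Prop where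
  x_meas : ∀ k, StronglyMeasurable[𝓖 (toLex (k, 0))] (Z.x k)
  xb_meas : ∀ k, StronglyMeasurable[𝓖 (toLex (k, 0))] (Z.xb k)
  y_meas : ∀ k, StronglyMeasurable[𝓖 (toLex (k, 0))] (Z.y k)
  lam_meas : ∀ k, StronglyMeasurable[𝓖 (toLex (k, 0))] (Z.lam k)
  M_meas : ∀ k i j, StronglyMeasurable[𝓖 (toLex (k, 0))] (fun ω => Z.M k ω i j)
  xin_meas : ∀ k, ∀ t ∈ Finset.Icc 1 (S.m k),
    StronglyMeasurable[𝓖 (toLex (k, t - 1))] (Z.xin k t)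
  xbin_meas : ∀ k, ∀ t ∈ Finset.Icc 1 (S.m k),
    StronglyMeasurable[𝓖 (toLex (k, t - 1))] (Z.xbin k t)
  ξ_meas : ∀ k, ∀ t ∈ Finset.Icc 1 (S.m k), Measurable[𝓖 (toLex (k, t))] (Z.ξ k t)
  ξ_unif : ∀ k, ∀ t ∈ Finset.Icc 1 (S.m k), ∀ j, μ.real {ω | Z.ξ k t ω = j} = 1 / (N : ℝ)
  ξ_indep : ∀ k, ∀ t ∈ Finset.Icc 1 (S.m k),
    Indep (MeasurableSpace.comap (Z.ξ k t) inferInstance) (𝓖 (toLex (k, t - 1))) μ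
  e_meas : ∀ k, ∀ t ∈ Finset.Icc 1 (S.m k), StronglyMeasurable[𝓖 (toLex (k, t))] (Z.e k t)
  e_int : ∀ k, ∀ t ∈ Finset.Icc 1 (S.m k), Integrable (Z.e k t) μ
  e_mean : ∀ k, ∀ t ∈ Finset.Icc 1 (S.m k), μ[Z.e k t | 𝓖 (toLex (k, t - 1))] =ᵐ[μ] 0

/-- A run of the symmetric accelerated stochastic ADMM from a deterministic starting point
`(x⁰, y⁰, λ⁰) ∈ X × Y × ℝⁿ`. -/
structure IsRun [MeasurableSpace Ω] (P : Problem n n₁ n₂ N) (S : Params n₁ n₂) (μ : Measure Ω)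
    (𝓖 : Filtration (ℕ ×ₗ ℕ) (inferInstance : MeasurableSpace Ω)) : Prop where
  x_zero : ∃ x₀ ∈ P.X, ∀ ω, Z.x 0 ω = x₀
  y_zero : ∃ y₀ ∈ P.Y, ∀ ω, Z.y 0 ω = y₀
  lam_zero : ∃ lam₀, ∀ ω, Z.lam 0 ω = lam₀
  updates : ∀ ω, Z.Updates P S ω
  sampling : Z.Sampling S μ 𝓖

/-- The `x`-part of the ergodic average: the mean of `x̃ᵏ = x^{k+1}` over `κ ≤ k ≤ κ + T`. -/
def xErg (κ T : ℕ) (ω : Ω) : Vec n₁ :=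
  (1 / ((T : ℝ) + 1)) • ∑ k ∈ Finset.Icc κ (κ + T), Z.x (k + 1) ω

/-- The `y`-part of the ergodic average: the mean of `ỹᵏ = y^{k+1}` over `κ ≤ k ≤ κ + T`. -/
def yErg (κ T : ℕ) (ω : Ω) : Vec n₂ :=
  (1 / ((T : ℝ) + 1)) • ∑ k ∈ Finset.Icc κ (κ + T), Z.y (k + 1) ω

end Trajectory

end

end SASADMM

/-! The core is an inequality along each single outcome ω; probability enters only when that
inequality is integrated.

The inner loop is an accelerated gradient method for the linearized `x`-subproblem. In
`accelerated_step` the optimality gap is weighted by t(t+1)/2. These weights telescope and the first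
one vanishes, so `Updates.gap_le` bounds the gap of a whole outer iteration by a difference of
distances ‖x̆ᵏ - x*‖_H² - ‖x̆ᵏ⁺¹ - x*‖_H², with coefficient 2/(m_k(m_k+1)η_k), plus a noise term.
This coefficient equals 2/min(c₁, c₂m_k(m_k+1)), hence is nonincreasing in k, and the distances
telescope over k as well.

The outer iteration is a two-block symmetric ADMM. Adding the optimality condition of the `y`-step
to the gap and inserting the two multiplier updates leaves an expression in residuals and increments
of By. `dual_step` turns it into the decrease of a quadratic form in (By, λ), of a residual term and
of an `L`-term. The sign of the leftover is exactly the polynomial condition in Δ. Thus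
`Updates.outer_step` holds for every multiplier l, with a nonnegative Lyapunov function `potential`.

Summing, averaging and Jensen's inequality give F(w_T) - F(w*) - ⟨l, r_T⟩ ≤ W, where r_T is the
residual of the averages and W is 1/(T+1) times the initial terms plus the summed noise. Taking l
opposite to r_T with norm ‖λ*‖ + 1, and using the saddle inequality F(w_T) - F(w*) ≥ ⟨λ*, r_T⟩,
bounds both ‖r_T‖ and |F(w_T) - F(w*)| by multiples of W. This l depends on ω, which is harmless:
the noise does not involve l, and the initial potential is bounded by one integrable variable for
all l in a ball.

In expectation the linear part of the noise vanishes, because δ_t is uncorrelated with the past, and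
the quadratic part of iteration k is at most c₁σ²/m_k. Since m_k ≥ c₃k^ϱ, the sum of 1/m_k is
bounded for ϱ > 1 and O(log T) for ϱ = 1. The expectations exist because the iterates, seen through
the quantities that occur, are square integrable (`IsRun.sqIntegrable`). -/

namespace SASADMM

/-! ### Weighted quadratic forms. -/

section LinearAlgebra

variable {p q : ℕ}

theorem act_add (G : Matrix (Fin p) (Fin q) ℝ) (u v : Vec q) : act G (u + v) = act G u + act G v :=
  map_add _ _ _

theorem act_sub (G : Matrix (Fin p) (Fin q) ℝ) (u v : Vec q) : act G (u - v) = act G u - act G v :=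
  map_sub _ _ _

theorem act_neg (G : Matrix (Fin p) (Fin q) ℝ) (u : Vec q) : act G (-u) = -act G u :=
  map_neg _ _

theorem act_smul (G : Matrix (Fin p) (Fin q) ℝ) (c : ℝ) (u : Vec q) :
    act G (c • u) = c • act G u :=
  map_smul _ _ _

theorem act_sum {ι : Type*} (G : Matrix (Fin p) (Fin q) ℝ) (s : Finset ι) (u : ι → Vec q) :
    act G (∑ i ∈ s, u i) = ∑ i ∈ s, act G (u i) :=
  map_sum _ _ _

theorem add_act (G G' : Matrix (Fin p) (Fin q) ℝ) (u : Vec q) :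
    act (G + G') u = act G u + act G' u := by
  simp [act]

theorem sub_act (G G' : Matrix (Fin p) (Fin q) ℝ) (u : Vec q) :
    act (G - G') u = act G u - act G' u := by
  simp [act]

theorem smul_act (c : ℝ) (G : Matrix (Fin p) (Fin q) ℝ) (u : Vec q) :
    act (c • G) u = c • act G u := by
  simp [act]

theorem one_act (u : Vec q) : act (1 : Matrix (Fin q) (Fin q) ℝ) u = u := by
  ext i; simp [act]

theorem mul_act {r : ℕ} (G : Matrix (Fin p) (Fin q) ℝ) (G' : Matrix (Fin q) (Fin r) ℝ)
    (u : Vec r) : act (G * G') u = act G (act G' u) := by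
  ext i; simp [act]

theorem continuous_act (G : Matrix (Fin p) (Fin q) ℝ) : Continuous (act G) :=
  LinearMap.continuous_of_finiteDimensional _

theorem inner_transpose_act (G : Matrix (Fin p) (Fin q) ℝ) (u : Vec p) (v : Vec q) :
    inner ℝ (act Gᵀ u) v = inner ℝ u (act G v) := by
  have := Matrix.toEuclideanLin_conjTranspose_eq_adjoint G
  rw [Matrix.conjTranspose_eq_transpose_of_trivial] at this
  simp only [act, this]
  exact LinearMap.adjoint_inner_left _ _ _

theorem inner_act_comm {G : Matrix (Fin q) (Fin q) ℝ} (hG : G.IsHermitian) (u v : Vec q) :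
    inner ℝ u (act G v) = inner ℝ v (act G u) := by
  have h : Gᵀ = G := by
    rw [← Matrix.conjTranspose_eq_transpose_of_trivial]; exact hG
  rw [← inner_transpose_act, h, real_inner_comm]

theorem sqNormW_nonneg {G : Matrix (Fin q) (Fin q) ℝ} (hG : G.PosSemidef) (v : Vec q) :
    0 ≤ sqNormW G v := by
  have := (Matrix.isPositive_toEuclideanLin_iff.2 hG).inner_nonneg_right v
  simpa [sqNormW, act] using this

theorem sqNormW_add {G : Matrix (Fin q) (Fin q) ℝ} (hG : G.IsHermitian) (u v : Vec q) :
    sqNormW G (u + v) = sqNormW G u + 2 * inner ℝ u (act G v) + sqNormW G v := by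
  simp only [sqNormW, act_add, inner_add_left, inner_add_right]
  rw [inner_act_comm hG v u]; ring

theorem sqNormW_sub {G : Matrix (Fin q) (Fin q) ℝ} (hG : G.IsHermitian) (u v : Vec q) :
    sqNormW G (u - v) = sqNormW G u - 2 * inner ℝ u (act G v) + sqNormW G v := by
  simp only [sqNormW, act_sub, inner_sub_left, inner_sub_right]
  rw [inner_act_comm hG v u]; ring

theorem sqNormW_smul (G : Matrix (Fin q) (Fin q) ℝ) (c : ℝ) (u : Vec q) :
    sqNormW G (c • u) = c ^ 2 * sqNormW G u := by
  simp only [sqNormW, act_smul, real_inner_smul_left, real_inner_smul_right]; ring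

theorem sqNormW_neg (G : Matrix (Fin q) (Fin q) ℝ) (u : Vec q) :
    sqNormW G (-u) = sqNormW G u := by
  simp [sqNormW, act_neg]

theorem sqNormW_sub_comm (G : Matrix (Fin q) (Fin q) ℝ) (u v : Vec q) :
    sqNormW G (u - v) = sqNormW G (v - u) := by
  rw [← neg_sub, sqNormW_neg]

theorem continuous_sqNormW (G : Matrix (Fin q) (Fin q) ℝ) : Continuous (sqNormW G) :=
  continuous_id.inner (continuous_act G)

/-- The weighted form of `2ab ≤ a² + b²`. -/
theorem two_mul_inner_act_le {G : Matrix (Fin q) (Fin q) ℝ} (hG : G.PosSemidef) (u v : Vec q) :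
    2 * inner ℝ u (act G v) ≤ sqNormW G u + sqNormW G v := by
  have := sqNormW_nonneg hG (u - v)
  rw [sqNormW_sub hG.isHermitian] at this
  linarith

theorem normW_sq {G : Matrix (Fin q) (Fin q) ℝ} (hG : G.PosSemidef) (u : Vec q) :
    normW G u ^ 2 = sqNormW G u :=
  Real.sq_sqrt (sqNormW_nonneg hG u)

theorem act_inv_act {H : Matrix (Fin q) (Fin q) ℝ} (hH : H.PosDef) (u : Vec q) :
    act H⁻¹ (act H u) = u := by
  rw [← mul_act, Matrix.nonsing_inv_mul _ (Matrix.isUnit_iff_isUnit_det _ |>.1 hH.isUnit), one_act]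

/-- Young's inequality for the dual pair of norms `‖·‖_{H⁻¹}`, `‖·‖_H`. -/
theorem two_mul_inner_le {H : Matrix (Fin q) (Fin q) ℝ} (hH : H.PosDef) (c : ℝ) (u v : Vec q) :
    2 * c * inner ℝ u v ≤ sqNormW H⁻¹ u + c ^ 2 * sqNormW H v := by
  -- With `act H (c • v)` in the second slot, H⁻¹ and H cancel in the cross term, and the H⁻¹-form
  -- of this vector is c²‖v‖_H².
  have h := two_mul_inner_act_le hH.inv.posSemidef u (act H (c • v))
  have h2 : sqNormW H⁻¹ (act H (c • v)) = c ^ 2 * sqNormW H v := by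
    rw [← sqNormW_smul]
    simp only [sqNormW]
    rw [act_inv_act hH, real_inner_comm]
  rw [h2, act_inv_act hH, real_inner_smul_right] at h
  linarith

theorem exists_norm_act_le (G : Matrix (Fin p) (Fin q) ℝ) :
    ∃ C : ℝ, 0 < C ∧ ∀ v, ‖act G v‖ ≤ C * ‖v‖ :=
  let T := LinearMap.toContinuousLinearMap (Matrix.toEuclideanLin G)
  ⟨‖T‖ + 1, by positivity, fun v => (T.le_opNorm v).trans (by gcongr; linarith)⟩

theorem exists_sqNormW_le (G : Matrix (Fin q) (Fin q) ℝ) :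
    ∃ C : ℝ, 0 < C ∧ ∀ v, sqNormW G v ≤ C * ‖v‖ ^ 2 := by
  obtain ⟨C, hC, h⟩ := exists_norm_act_le G
  refine ⟨C, hC, fun v => (real_inner_le_norm _ _).trans ?_⟩
  nlinarith [h v, norm_nonneg v]

/-- Coercivity without eigenvalues: if ‖·‖_H² ≤ C‖·‖², Young's inequality with constant 1/C gives
(2/C)‖v‖² ≤ ‖v‖_{H⁻¹}² + (1/C)‖v‖². -/
theorem exists_le_sqNormW_inv {H : Matrix (Fin q) (Fin q) ℝ} (hH : H.PosDef) :
    ∃ c : ℝ, 0 < c ∧ ∀ v, c * ‖v‖ ^ 2 ≤ sqNormW H⁻¹ v := by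
  obtain ⟨C, hC, h⟩ := exists_sqNormW_le H
  refine ⟨1 / C, by positivity, fun v => ?_⟩
  have h1 := two_mul_inner_le hH (1 / C) v v
  rw [real_inner_self_eq_norm_sq] at h1
  have h2 : (1 / C) ^ 2 * sqNormW H v ≤ (1 / C) ^ 2 * (C * ‖v‖ ^ 2) := by gcongr; exact h v
  have h3 : (1 / C) ^ 2 * (C * ‖v‖ ^ 2) = 1 / C * ‖v‖ ^ 2 := by field_simp
  linarith

theorem exists_le_sqNormW {H : Matrix (Fin q) (Fin q) ℝ} (hH : H.PosDef) :
    ∃ c : ℝ, 0 < c ∧ ∀ v, c * ‖v‖ ^ 2 ≤ sqNormW H v := by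
  have := exists_le_sqNormW_inv hH.inv
  rwa [Matrix.nonsing_inv_nonsing_inv _ (Matrix.isUnit_iff_isUnit_det _ |>.1 hH.isUnit)] at this

end LinearAlgebra

/-! ### First-order conditions, convexity and smoothness. -/

/-- A first-order condition: the linear coefficient of a quadratic that is nonnegative on `(0, 1]`
is nonnegative. -/
theorem nonneg_of_forall_quadratic {l c : ℝ} (h : ∀ r : ℝ, 0 < r → r ≤ 1 → 0 ≤ r * l + r ^ 2 * c) :
    0 ≤ l := by
  by_contra! hl
  have hc : 0 < |c| + 1 - l := by have := abs_nonneg c; linarith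
  -- The test value r = -l/(|c| + 1 - l) lies in (0, 1] and makes l + r|c| = -r(1 - l) negative.
  have hr1 : -l / (|c| + 1 - l) ≤ 1 := by
    rw [div_le_one hc]; have := abs_nonneg c; linarith
  have hr0 : 0 < -l / (|c| + 1 - l) := div_pos (by linarith) hc
  have := h _ hr0 hr1
  set r := -l / (|c| + 1 - l)
  have h1 : 0 ≤ l + r * c := by nlinarith
  have h2 : r * (|c| + 1 - l) = -l := div_mul_cancel₀ _ hc.ne'
  have h3 : r * c ≤ r * |c| := by gcongr; exact le_abs_self c
  nlinarith

/-- The variational inequality at a minimizer of a linear plus two quadratic terms. -/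
theorem variational_ineq_of_isMinOn {q : ℕ} {X : Set (Vec q)} (hX : Convex ℝ X)
    {H M : Matrix (Fin q) (Fin q) ℝ} (hH : H.IsHermitian) (hM : M.IsHermitian) {a : ℝ}
    {c u w z : Vec q} (hz : z ∈ X)
    (hmin : IsMinOn (fun x => inner ℝ c x + a / 2 * sqNormW H (x - u)
      + 1 / 2 * sqNormW M (x - w)) X z) {x : Vec q} (hx : x ∈ X) :
    0 ≤ inner ℝ c (x - z) + a * inner ℝ (x - z) (act H (z - u))
      + inner ℝ (x - z) (act M (z - w)) := by
  refine nonneg_of_forall_quadratic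
    (c := a / 2 * sqNormW H (x - z) + 1 / 2 * sqNormW M (x - z)) fun r hr0 hr1 => ?_
  have hmem : z + r • (x - z) ∈ X := hX.add_smul_sub_mem hz hx ⟨hr0.le, hr1⟩
  have h := isMinOn_iff.1 hmin _ hmem
  have e : ∀ w', z + r • (x - z) - w' = r • (x - z) + (z - w') := fun w' => by abel
  simp only [e, sqNormW_add hH, sqNormW_add hM, sqNormW_smul, real_inner_smul_left,
    inner_add_right, real_inner_smul_right] at h
  linarith

section Smooth

variable {q : ℕ}

theorem hasDerivAt_line {φ : Vec q → ℝ} {z d : Vec q} {r : ℝ}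
    (h : DifferentiableAt ℝ φ (z + r • d)) :
    HasDerivAt (fun s : ℝ => φ (z + s • d)) (inner ℝ (gradient φ (z + r • d)) d) r := by
  have h1 : HasDerivAt (fun s : ℝ => z + s • d) d r := by
    simpa using ((hasDerivAt_id r).smul_const d).const_add z
  have h2 := h.hasGradientAt.hasFDerivAt.comp_hasDerivAt r h1
  exact h2

theorem add_inner_gradient_le_of_convexOn {X : Set (Vec q)} {φ : Vec q → ℝ} (hφ : ConvexOn ℝ X φ)
    {x z : Vec q} (hx : x ∈ X) (hz : z ∈ X) (hd : DifferentiableAt ℝ φ z) :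
    φ z + inner ℝ (gradient φ z) (x - z) ≤ φ x := by
  have hconv : ConvexOn ℝ (Set.Icc (0 : ℝ) 1) (fun s : ℝ => φ (z + s • (x - z))) := by
    refine ⟨convex_Icc 0 1, fun a ha b hb u v hu hv huv => ?_⟩
    have hmem : ∀ s ∈ Set.Icc (0 : ℝ) 1, z + s • (x - z) ∈ X := fun s hs =>
      hφ.1.add_smul_sub_mem hz hx hs
    have := hφ.2 (hmem a ha) (hmem b hb) hu hv huv
    convert this using 2
    have : z = (u + v) • z := by rw [huv, one_smul]
    nth_rewrite 1 [this]
    simp only [smul_eq_mul]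
    module
  have h0 : HasDerivAt (fun s : ℝ => φ (z + s • (x - z)))
      (inner ℝ (gradient φ z) (x - z)) 0 := by
    have := hasDerivAt_line (φ := φ) (z := z) (d := x - z) (r := 0) (by simpa using hd)
    simpa using this
  have h1 := hconv.le_slope_of_hasDerivAt (by simp) (by simp) zero_lt_one h0
  simp only [slope_def_field, one_smul, zero_smul, add_zero, add_sub_cancel, sub_zero,
    div_one] at h1
  linarith

/-- The descent lemma, without integration: along the segment, φ minus its quadratic model has
nonpositive derivative, so its value at 1 is at most its value at 0. -/
theorem le_add_sqNormW_of_gradient_lipschitz {X : Set (Vec q)} (hX : Convex ℝ X) {φ : Vec q → ℝ}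
    {H : Matrix (Fin q) (Fin q) ℝ} (hH : H.PosDef) {ν : ℝ} (hν : 0 < ν)
    (hd : ∀ x ∈ X, DifferentiableAt ℝ φ x)
    (hLip : ∀ x₁ ∈ X, ∀ x₂ ∈ X,
      normW H⁻¹ (gradient φ x₁ - gradient φ x₂) ≤ ν * normW H (x₁ - x₂))
    {x z : Vec q} (hx : x ∈ X) (hz : z ∈ X) :
    φ x ≤ φ z + inner ℝ (gradient φ z) (x - z) + ν / 2 * sqNormW H (x - z) := by
  set d := x - z with hd'
  have hmem : ∀ s ∈ Set.Icc (0 : ℝ) 1, z + s • d ∈ X := fun s hs =>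
    hX.add_smul_sub_mem hz hx hs
  have hder : ∀ r ∈ Set.Icc (0 : ℝ) 1, HasDerivAt
      (fun s : ℝ => φ (z + s • d) - s * inner ℝ (gradient φ z) d - ν / 2 * s ^ 2 * sqNormW H d)
      (inner ℝ (gradient φ (z + r • d)) d - inner ℝ (gradient φ z) d - ν * r * sqNormW H d) r := by
    intro r hr
    have h1 := hasDerivAt_line (hd _ (hmem r hr))
    have h2 := (hasDerivAt_id r).mul_const (inner ℝ (gradient φ z) d)
    have h3 := ((((hasDerivAt_id r).pow 2).const_mul (ν / 2)).mul_const (sqNormW H d))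
    refine ((h1.sub h2).sub h3).congr_deriv ?_
    simp only [id_eq, Nat.cast_ofNat]
    ring
  have hanti : AntitoneOn
      (fun s : ℝ => φ (z + s • d) - s * inner ℝ (gradient φ z) d - ν / 2 * s ^ 2 * sqNormW H d)
      (Set.Icc 0 1) := by
    refine antitoneOn_of_deriv_nonpos (convex_Icc 0 1)
      (fun r hr => (hder r hr).continuousAt.continuousWithinAt)
      (fun r hr => (hder r (interior_subset hr)).differentiableAt.differentiableWithinAt)
      (fun r hr => ?_)
    rw [(hder r (interior_subset hr)).deriv]
    rw [interior_Icc] at hr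
    have hr0 : 0 < ν * r := mul_pos hν hr.1
    have hL := hLip _ (hmem r ⟨hr.1.le, hr.2.le⟩) _ hz
    have hS : sqNormW H (z + r • d - z) = r ^ 2 * sqNormW H d := by
      rw [add_sub_cancel_left, sqNormW_smul]
    have hL2 : sqNormW H⁻¹ (gradient φ (z + r • d) - gradient φ z)
        ≤ (ν * r) ^ 2 * sqNormW H d := by
      rw [← normW_sq hH.inv.posSemidef, mul_pow, mul_assoc, ← hS, ← normW_sq hH.posSemidef,
        ← mul_pow]
      exact pow_le_pow_left₀ (Real.sqrt_nonneg _) hL 2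
    -- The constant νr balances Young's inequality: both terms on the right are at most (νr)²‖d‖_H²,
    -- and division by 2νr gives the derivative bound.
    have hY := two_mul_inner_le hH (ν * r) (gradient φ (z + r • d) - gradient φ z) d
    rw [inner_sub_left] at hY
    nlinarith
  have := hanti (Set.left_mem_Icc.2 zero_le_one) (Set.right_mem_Icc.2 zero_le_one) zero_le_one
  simp only [one_smul, zero_smul, add_zero] at this
  rw [hd', add_sub_cancel, ← hd'] at this
  linarith

end Smooth

namespace Problem

variable {n n₁ n₂ N : ℕ} {P : Problem n n₁ n₂ N}

theorem Standing.hasGradientAt_f (hP : P.Standing) {x : Vec n₁} (hx : x ∈ P.X) :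
    HasGradientAt P.f ((1 / (N : ℝ)) • ∑ j, gradient (P.fj j) x) x := by
  rw [hasGradientAt_iff_hasFDerivAt, map_smul, map_sum]
  have := (HasFDerivAt.fun_sum (u := Finset.univ)
    fun j _ => (hP.diff_f j x hx).hasGradientAt.hasFDerivAt).const_mul (1 / (N : ℝ))
  exact this

theorem Standing.gradient_f (hP : P.Standing) {x : Vec n₁} (hx : x ∈ P.X) :
    gradient P.f x = (1 / (N : ℝ)) • ∑ j, gradient (P.fj j) x :=
  (hP.hasGradientAt_f hx).gradient

theorem Standing.convexOn_f (hP : P.Standing) : ConvexOn ℝ P.X P.f := by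
  have h : ConvexOn ℝ P.X (fun x => ∑ j, P.fj j x) := by
    refine ⟨hP.convex_X, fun x hx y hy a b ha hb hab => ?_⟩
    simp only [Finset.smul_sum, ← Finset.sum_add_distrib]
    exact Finset.sum_le_sum fun j _ => (hP.convex_f j).2 hx hy ha hb hab
  exact h.smul (by positivity : (0 : ℝ) ≤ 1 / (N : ℝ))

/-- Convexity and smoothness combined: a linear upper model centred at `z`. -/
theorem Standing.f_le (hP : P.Standing) {H : Matrix (Fin n₁) (Fin n₁) ℝ} (hH : H.PosDef)
    {ν : ℝ} (hν : 0 < ν) (hLip : P.GradLipschitz H ν) {x y z : Vec n₁} (hx : x ∈ P.X)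
    (hy : y ∈ P.X) (hz : z ∈ P.X) :
    P.f y ≤ P.f x + inner ℝ (gradient P.f z) (y - x) + ν / 2 * sqNormW H (y - z) := by
  have hj : ∀ j, P.fj j y ≤ P.fj j x + inner ℝ (gradient (P.fj j) z) (y - x)
      + ν / 2 * sqNormW H (y - z) := fun j => by
    have h1 := add_inner_gradient_le_of_convexOn (hP.convex_f j) hx hz (hP.diff_f j z hz)
    have h2 := le_add_sqNormW_of_gradient_lipschitz hP.convex_X hH hν (hP.diff_f j) (hLip j) hy hz
    rw [inner_sub_right] at h1 h2 ⊢
    linarith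
  have hsum := Finset.sum_le_sum fun j (_ : j ∈ Finset.univ) => hj j
  have h0 : 0 ≤ ν / 2 * sqNormW H (y - z) :=
    mul_nonneg (by positivity) (sqNormW_nonneg hH.posSemidef _)
  rw [hP.gradient_f hz, real_inner_smul_left, sum_inner]
  unfold f
  have hmul := mul_le_mul_of_nonneg_left hsum (by positivity : (0 : ℝ) ≤ 1 / (N : ℝ))
  simp only [Finset.sum_add_distrib, Finset.sum_const, Finset.card_univ, Fintype.card_fin,
    nsmul_eq_mul, mul_add] at hmul
  have h1 : 1 / (N : ℝ) * ((N : ℝ) * (ν / 2 * sqNormW H (y - z))) ≤ ν / 2 * sqNormW H (y - z) := by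
    -- For N = 0 the factor 1/N is 0, so the averaged quadratic term is only bounded by, not equal
    -- to, the right-hand side.
    rcases Nat.eq_zero_or_pos N with h | h
    · simp [h]; simpa using h0
    · have : (N : ℝ) ≠ 0 := by positivity
      field_simp; rfl
  linarith

end Problem

/-! ### One step of the accelerated inner loop. -/

/-- The linear-quadratic term of the `x`-subproblem gap is convex along segments. -/
theorem inner_add_act_combo_le {q : ℕ} {M : Matrix (Fin q) (Fin q) ℝ} (hM : M.PosSemidef)
    (h c x u w : Vec q) {b : ℝ} (hb0 : 0 ≤ b) (hb1 : b ≤ 1) :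
    inner ℝ (h + act M (b • u + (1 - b) • w - c)) (b • u + (1 - b) • w - x)
      ≤ b * inner ℝ (h + act M (u - c)) (u - x)
        + (1 - b) * inner ℝ (h + act M (w - c)) (w - x) := by
  -- Recentred at x, the expression is a linear form plus ‖z - x‖_M², hence convex in z.
  have key : ∀ z : Vec q, inner ℝ (h + act M (z - c)) (z - x)
      = inner ℝ (h + act M (x - c)) (z - x) + sqNormW M (z - x) := fun z => by
    have : z - c = (x - c) + (z - x) := by abel
    rw [this, act_add, ← add_assoc, inner_add_left, sqNormW, real_inner_comm (act M (z - x))]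
  have e : b • u + (1 - b) • w - x = b • (u - x) + (1 - b) • (w - x) := by module
  rw [key, key u, key w, e, inner_add_right, real_inner_smul_right, real_inner_smul_right,
    sqNormW_add hM.isHermitian, sqNormW_smul, sqNormW_smul, act_smul, real_inner_smul_left,
    real_inner_smul_right]
  have h2 := two_mul_inner_act_le hM (u - x) (w - x)
  nlinarith [mul_nonneg hb0 (sub_nonneg.2 hb1)]

/-- One step of the accelerated stochastic gradient subroutine. -/
theorem accelerated_step {n n₁ n₂ N : ℕ} {P : Problem n n₁ n₂ N} (hP : P.Standing)
    {H M : Matrix (Fin n₁) (Fin n₁) ℝ} (hH : H.PosDef) (hM : M.PosSemidef)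
    {ν η t : ℝ} (hν : 0 < ν) (hLip : P.GradLipschitz H ν) (hη0 : 0 < η) (hη : η ≤ 1 / (2 * ν))
    (ht : 1 ≤ t) {x xk xb xt xb' xt' xhat d h : Vec n₁} (hx : x ∈ P.X) (hxb : xb ∈ P.X)
    (hxt : xt ∈ P.X) (hxb' : xb' ∈ P.X)
    (hxhat : xhat = (2 / (t + 1)) • xb + (1 - 2 / (t + 1)) • xt)
    (hxt' : xt' = (2 / (t + 1)) • xb' + (1 - 2 / (t + 1)) • xt)
    (hmin : IsMinOn (fun z => inner ℝ (d + h) z + (2 / (t * η)) / 2 * sqNormW H (z - xb)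
      + 1 / 2 * sqNormW M (z - xk)) P.X xb') :
    t * (t + 1) / 2 * (P.f xt' - P.f x + inner ℝ (h + act M (xt' - xk)) (xt' - x))
      ≤ (t - 1) * t / 2 * (P.f xt - P.f x + inner ℝ (h + act M (xt - xk)) (xt - x))
        + 1 / η * (sqNormW H (xb - x) - sqNormW H (xb' - x))
        + t * inner ℝ (gradient P.f xhat - d) (xb - x)
        + η / 2 * (t ^ 2 * sqNormW H⁻¹ (gradient P.f xhat - d)) := by
  have hb0 : 0 ≤ 2 / (t + 1) := by positivity
  have hb1 : 2 / (t + 1) ≤ 1 := by rw [div_le_one (by linarith)]; linarith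
  set b := 2 / (t + 1) with hb
  have hcomb : ∀ u ∈ P.X, b • u + (1 - b) • xt ∈ P.X := fun u hu =>
    hP.convex_X hu hxt hb0 (by linarith) (by ring)
  have hxhatX : xhat ∈ P.X := hxhat ▸ hcomb xb hxb
  have hxtX' : xt' ∈ P.X := hxt' ▸ hcomb xb' hxb'
  -- The model at x̂ compares f(x_{t+1}) with both f(x_t) and f(x). Mixed with weights 1 - b and b,
  -- the two slopes combine into b⟨∇f(x̂), x̆_{t+1} - x⟩.
  have S1a := hP.f_le hH hν hLip hxt hxtX' hxhatX
  have S1b := hP.f_le hH hν hLip hx hxtX' hxhatX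
  have e1 : xt' - xhat = b • (xb' - xb) := by rw [hxt', hxhat]; module
  rw [e1, sqNormW_smul] at S1a S1b
  have S1 : P.f xt' ≤ (1 - b) * P.f xt + b * P.f x
      + b * inner ℝ (gradient P.f xhat) (xb' - x)
      + ν / 2 * (b ^ 2 * sqNormW H (xb' - xb)) := by
    have e2 : (1 - b) * inner ℝ (gradient P.f xhat) (xt' - xt)
        + b * inner ℝ (gradient P.f xhat) (xt' - x)
        = b * inner ℝ (gradient P.f xhat) (xb' - x) := by
      rw [← real_inner_smul_right, ← real_inner_smul_right, ← inner_add_right,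
        ← real_inner_smul_right, hxt']
      congr 1; module
    have h1 := mul_le_mul_of_nonneg_left S1a (sub_nonneg.2 hb1)
    have h2 := mul_le_mul_of_nonneg_left S1b hb0
    linarith
  have S2 := variational_ineq_of_isMinOn hP.convex_X hH.isHermitian hM.isHermitian hxb' hmin hx
  have S3 := sqNormW_add hH.isHermitian (x - xb') (xb' - xb)
  rw [sub_add_sub_cancel, sqNormW_sub_comm H x xb, sqNormW_sub_comm H x xb'] at S3
  have S4 := inner_add_act_combo_le hM h xk x xb' xt hb0 hb1
  rw [← hxt'] at S4
  -- With this constant the noise cross term uses half of the a/η gained from the three-point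
  -- identity `S3`; the other half absorbs the curvature term, since η ≤ 1/(2ν).
  have S5 := two_mul_inner_le hH (1 / (t * η)) (gradient P.f xhat - d) (xb' - xb)
  set a := sqNormW H (xb' - xb)
  have ha : 0 ≤ a := sqNormW_nonneg hH.posSemidef _
  set dl := gradient P.f xhat - d with hdl
  have hg : gradient P.f xhat = d + dl := by rw [hdl]; abel
  have e3 : inner ℝ (gradient P.f xhat) (xb' - x)
      = inner ℝ d (xb' - x) + inner ℝ dl (xb' - xb) + inner ℝ dl (xb - x) := by
    rw [hg, inner_add_left, add_assoc, ← inner_add_right, sub_add_sub_cancel]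
  have e4 : inner ℝ (d + h) (x - xb') + inner ℝ (x - xb') (act M (xb' - xk))
      = -(inner ℝ d (xb' - x) + inner ℝ (h + act M (xb' - xk)) (xb' - x)) := by
    rw [← neg_sub xb' x, inner_neg_right, inner_neg_left, inner_add_left, inner_add_left,
      real_inner_comm (act M (xb' - xk))]
    ring
  rw [e3] at S1
  set ψ' := inner ℝ (h + act M (xt' - xk)) (xt' - x)
  set ψ := inner ℝ (h + act M (xt - xk)) (xt - x)
  set ψb := inner ℝ (h + act M (xb' - xk)) (xb' - x)
  set D := sqNormW H⁻¹ dl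
  set A := sqNormW H (xb - x)
  set A' := sqNormW H (xb' - x)
  set i1 := inner ℝ dl (xb' - xb)
  set i2 := inner ℝ dl (xb - x)
  set i3 := inner ℝ d (xb' - x)
  set i4 := inner ℝ (x - xb') (act H (xb' - xb))
  have ht0 : 0 < t := by linarith
  have T2 : i3 + ψb ≤ 1 / (t * η) * (A - A' - a) := by
    have : (2 / (t * η)) * i4 = 1 / (t * η) * (A - A' - a) := by
      rw [S3]; ring
    linarith
  have T5 : t * i1 ≤ η / 2 * (t ^ 2 * D) + a / (2 * η) := by
    have := mul_le_mul_of_nonneg_left S5 (by positivity : 0 ≤ t ^ 2 * η / 2)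
    have e5 : t ^ 2 * η / 2 * (2 * (1 / (t * η)) * i1) = t * i1 := by field_simp
    have e6 : t ^ 2 * η / 2 * (D + (1 / (t * η)) ^ 2 * a)
        = η / 2 * (t ^ 2 * D) + a / (2 * η) := by field_simp
    linarith
  have T6 : t * (t + 1) / 2 * (ν / 2 * (b ^ 2 * a)) ≤ a / (2 * η) := by
    have e7 : t * (t + 1) / 2 * (ν / 2 * (b ^ 2 * a)) = (t / (t + 1)) * (ν * a) := by
      rw [hb]; field_simp
    have h1 : t / (t + 1) ≤ 1 := by rw [div_le_one (by linarith)]; linarith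
    have h2 : ν ≤ 1 / (2 * η) := by
      rw [le_div_iff₀ (by positivity)] at hη ⊢; linarith
    calc _ = (t / (t + 1)) * (ν * a) := e7
      _ ≤ 1 * (1 / (2 * η) * a) := by gcongr
      _ = _ := by ring
  have G : P.f xt' - P.f x + ψ' ≤ (1 - b) * (P.f xt - P.f x + ψ)
      + b * ((1 / (t * η) * (A - A' - a)) + i1 + i2) + ν / 2 * (b ^ 2 * a) := by
    have := mul_le_mul_of_nonneg_left T2 hb0
    linarith
  have G2 := mul_le_mul_of_nonneg_left G (by positivity : 0 ≤ t * (t + 1) / 2)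
  have e8 : t * (t + 1) / 2 * ((1 - b) * (P.f xt - P.f x + ψ)
      + b * ((1 / (t * η) * (A - A' - a)) + i1 + i2) + ν / 2 * (b ^ 2 * a))
      = (t - 1) * t / 2 * (P.f xt - P.f x + ψ) + 1 / η * (A - A') - a / η + t * i1 + t * i2
        + t * (t + 1) / 2 * (ν / 2 * (b ^ 2 * a)) := by
    have : t * (t + 1) / 2 * b = t := by rw [hb]; field_simp
    have h2 : t * (t + 1) / 2 * (1 - b) = (t - 1) * t / 2 := by rw [mul_sub, this]; ring
    have h3 : t * (1 / (t * η)) = 1 / η := by field_simp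
    rw [mul_add, mul_add, ← mul_assoc, h2, ← mul_assoc (t * (t + 1) / 2) b, this]
    have : t * (1 / (t * η) * (A - A' - a) + i1 + i2) = (t * (1 / (t * η))) * (A - A' - a)
      + t * i1 + t * i2 := by ring
    rw [this, h3]; ring
  have e9 : a / η = a / (2 * η) + a / (2 * η) := by field_simp; norm_num
  linarith

/-! ### Finite values of g, saddle points and the `y`-subproblem. -/

namespace Problem

variable {n n₁ n₂ N : ℕ} (P : Problem n n₁ n₂ N)

/-- The effective domain of `g` in `Y`. -/
def dom : Set (Vec n₂) := {y | y ∈ P.Y ∧ P.g y ≠ ⊤}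

/-- The real value of `g` on its effective domain. -/
noncomputable def gReal (y : Vec n₂) : ℝ := (P.g y).toReal

variable {P}

theorem Standing.coe_gReal (hP : P.Standing) {y : Vec n₂} (hy : y ∈ P.dom) :
    (P.gReal y : EReal) = P.g y :=
  EReal.coe_toReal hy.2 (hP.g_ne_bot y hy.1)

theorem Standing.convexOn_gReal (hP : P.Standing) : ConvexOn ℝ P.dom P.gReal := by
  have key : ∀ y ∈ P.dom, ∀ z ∈ P.dom, ∀ a b : ℝ, 0 ≤ a → 0 ≤ b → a + b = 1 →
      a • y + b • z ∈ P.Y ∧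
        P.g (a • y + b • z) ≤ ((a * P.gReal y + b * P.gReal z : ℝ) : EReal) := by
    intro y hy z hz a b ha hb hab
    have h1 : ((y, P.gReal y) : Vec n₂ × ℝ) ∈
        {p : Vec n₂ × ℝ | p.1 ∈ P.Y ∧ P.g p.1 ≤ (p.2 : EReal)} := ⟨hy.1, (hP.coe_gReal hy).ge⟩
    have h2 : ((z, P.gReal z) : Vec n₂ × ℝ) ∈
        {p : Vec n₂ × ℝ | p.1 ∈ P.Y ∧ P.g p.1 ≤ (p.2 : EReal)} := ⟨hz.1, (hP.coe_gReal hz).ge⟩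
    exact hP.convex_g h1 h2 ha hb hab
  have hmem : ∀ y ∈ P.dom, ∀ z ∈ P.dom, ∀ a b : ℝ, 0 ≤ a → 0 ≤ b → a + b = 1 →
      a • y + b • z ∈ P.dom := fun y hy z hz a b ha hb hab =>
    ⟨(key y hy z hz a b ha hb hab).1,
      ((key y hy z hz a b ha hb hab).2.trans_lt (EReal.coe_lt_top _)).ne⟩
  refine ⟨fun y hy z hz a b ha hb hab => hmem y hy z hz a b ha hb hab,
    fun y hy z hz a b ha hb hab => ?_⟩
  have := (key y hy z hz a b ha hb hab).2
  rw [← hP.coe_gReal (hmem y hy z hz a b ha hb hab)] at this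
  exact EReal.coe_le_coe_iff.1 this

theorem Standing.F_eq (hP : P.Standing) (x : Vec n₁) {y : Vec n₂} (hy : y ∈ P.dom) :
    P.F x y = ((P.f x + P.gReal y : ℝ) : EReal) := by
  rw [F, ← hP.coe_gReal hy, EReal.coe_add]

theorem Standing.lagr_eq (hP : P.Standing) (x : Vec n₁) {y : Vec n₂} (hy : y ∈ P.dom)
    (lam : Vec n) :
    P.lagr x y lam = ((P.f x + P.gReal y - inner ℝ lam (P.resid x y) : ℝ) : EReal) := by
  rw [lagr, hP.F_eq x hy, ← EReal.coe_add, sub_eq_add_neg]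

theorem F_eq_top {x : Vec n₁} {y : Vec n₂} (hy : P.g y = ⊤) : P.F x y = ⊤ := by
  rw [F, hy, EReal.coe_add_top]

/-- Comparison with (x*, y), where g(y) is finite, forces the Lagrangian to be finite at the saddle
point. -/
theorem IsSaddlePoint.mem_dom (hP : P.Standing) {xs : Vec n₁} {ys : Vec n₂} {ls : Vec n}
    (hw : P.IsSaddlePoint xs ys ls) : ys ∈ P.dom := by
  refine ⟨hw.mem_Y, fun h => ?_⟩
  obtain ⟨y, hy, hgy⟩ := hP.g_proper
  have := hw.le_right xs hw.mem_X y hy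
  rw [hP.lagr_eq xs ⟨hy, hgy⟩, lagr, F_eq_top h, EReal.top_add_coe, top_le_iff] at this
  exact EReal.coe_ne_top _ this

theorem IsSaddlePoint.le (hP : P.Standing) {xs : Vec n₁} {ys : Vec n₂} {ls : Vec n}
    (hw : P.IsSaddlePoint xs ys ls) (lam : Vec n) :
    inner ℝ ls (P.resid xs ys) ≤ inner ℝ lam (P.resid xs ys) := by
  have := hw.le_left lam
  rw [hP.lagr_eq _ (hw.mem_dom hP), hP.lagr_eq _ (hw.mem_dom hP), EReal.coe_le_coe_iff] at this
  linarith

theorem IsSaddlePoint.resid_eq_zero (hP : P.Standing) {xs : Vec n₁} {ys : Vec n₂} {ls : Vec n}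
    (hw : P.IsSaddlePoint xs ys ls) : P.resid xs ys = 0 := by
  -- Moving the multiplier by the residual itself makes the inequality read ‖r‖² ≤ 0.
  have := hw.le hP (ls - P.resid xs ys)
  rw [inner_sub_left, real_inner_self_eq_norm_sq] at this
  have h : ‖P.resid xs ys‖ ^ 2 ≤ 0 := by linarith
  simpa using h

theorem IsSaddlePoint.add_le (hP : P.Standing) {xs : Vec n₁} {ys : Vec n₂} {ls : Vec n}
    (hw : P.IsSaddlePoint xs ys ls) {x : Vec n₁} (hx : x ∈ P.X) {y : Vec n₂} (hy : y ∈ P.dom) :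
    P.f xs + P.gReal ys ≤ P.f x + P.gReal y - inner ℝ ls (P.resid x y) := by
  have := hw.le_right x hx y hy.1
  rw [hP.lagr_eq _ (hw.mem_dom hP), hP.lagr_eq _ hy, EReal.coe_le_coe_iff,
    hw.resid_eq_zero hP, inner_zero_right, sub_zero] at this
  exact this

theorem resid_eq (x x' : Vec n₁) (y y' : Vec n₂) :
    P.resid x y = P.resid x' y' + act P.A (x - x') + act P.B (y - y') := by
  simp only [resid, act_sub]; abel

/-- The optimality condition of the `y`-subproblem. -/
theorem Standing.y_optimality (hP : P.Standing) {L : Matrix (Fin n₂) (Fin n₂) ℝ}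
    (hL : L.IsHermitian) {β : ℝ} {x : Vec n₁} {lam : Vec n} {u z : Vec n₂} (hz : z ∈ P.Y)
    (hmin : IsMinOn (fun y => P.augLagr β x y lam + ((1 / 2 * sqNormW L (y - u) : ℝ) : EReal))
      P.Y z) :
    z ∈ P.dom ∧ ∀ y ∈ P.dom,
      P.gReal z - P.gReal y + inner ℝ (-lam + β • P.resid x z) (act P.B (z - y))
        + inner ℝ (z - y) (act L (z - u)) ≤ 0 := by
  have heq : ∀ y ∈ P.dom, P.augLagr β x y lam + ((1 / 2 * sqNormW L (y - u) : ℝ) : EReal)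
      = ((P.f x + P.gReal y - inner ℝ lam (P.resid x y) + β / 2 * ‖P.resid x y‖ ^ 2
        + 1 / 2 * sqNormW L (y - u) : ℝ) : EReal) := fun y hy => by
    rw [augLagr, hP.lagr_eq x hy, ← EReal.coe_add, ← EReal.coe_add]
  have hzd : z ∈ P.dom := by
    refine ⟨hz, fun h => ?_⟩
    obtain ⟨y, hy, hgy⟩ := hP.g_proper
    have := isMinOn_iff.1 hmin y hy
    rw [heq y ⟨hy, hgy⟩, augLagr, lagr, F_eq_top h, EReal.top_add_coe, EReal.top_add_coe,
      EReal.top_add_coe, top_le_iff] at this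
    exact EReal.coe_ne_top _ this
  refine ⟨hzd, fun y hy => ?_⟩
  suffices 0 ≤ P.gReal y - P.gReal z + inner ℝ (-lam + β • P.resid x z) (act P.B (y - z))
      + inner ℝ (y - z) (act L (z - u)) by
    rw [← neg_sub y z, act_neg, inner_neg_right, inner_neg_left]; linarith
  refine nonneg_of_forall_quadratic (c := β / 2 * ‖act P.B (y - z)‖ ^ 2
    + 1 / 2 * sqNormW L (y - z)) fun r hr0 hr1 => ?_
  have hmem : z + r • (y - z) ∈ P.dom := hP.convexOn_gReal.1.add_smul_sub_mem hzd hy ⟨hr0.le, hr1⟩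
  have h := isMinOn_iff.1 hmin _ hmem.1
  rw [heq z hzd, heq _ hmem, EReal.coe_le_coe_iff] at h
  have hg : P.gReal (z + r • (y - z)) ≤ (1 - r) * P.gReal z + r * P.gReal y := by
    have := hP.convexOn_gReal.2 hzd hy (by linarith : 0 ≤ 1 - r) hr0.le (by ring)
    have e : z + r • (y - z) = (1 - r) • z + r • y := by module
    rw [e]; exact this
  have e1 : P.resid x (z + r • (y - z)) = P.resid x z + r • act P.B (y - z) := by
    simp only [resid, act_add, act_smul]; abel
  have e2 : z + r • (y - z) - u = r • (y - z) + (z - u) := by abel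
  rw [e1, e2, sqNormW_add hL, sqNormW_smul, norm_add_sq_real, norm_smul, mul_pow,
    Real.norm_eq_abs, sq_abs] at h
  simp only [inner_add_right, real_inner_smul_right, real_inner_smul_left] at h
  rw [inner_add_left, inner_neg_left, real_inner_smul_left]
  linarith

end Problem

/-! ### The quadratic form in (By, λ) and the role of Δ. -/

section DualAlgebra

variable {E : Type*} [NormedAddCommGroup E] [InnerProductSpace ℝ E]

/-- The quadratic form that measures the distance of `(B y, λ)` from its target. -/
noncomputable def dualForm (β τ s : ℝ) (q l : E) : ℝ :=
  1 / 2 * ((1 - τ * s / (τ + s)) * β * ‖q‖ ^ 2 - 2 * τ / (τ + s) * inner ℝ q l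
    + 1 / (β * (τ + s)) * ‖l‖ ^ 2)

/-- Completing the square in l - τβq leaves the remainder (τ+s)(1-τ)β²‖q‖²; this uses τ + s > 0 and
τ ≤ 1. -/
theorem dualForm_nonneg {β τ s : ℝ} (hβ : 0 < β) (hΔ : (τ, s) ∈ Delta) (q l : E) :
    0 ≤ dualForm β τ s q l := by
  obtain ⟨h1, h2, -⟩ := hΔ
  simp only at h1 h2
  have h : dualForm β τ s q l = 1 / (2 * (β * (τ + s))) *
      (‖l - (τ * β) • q‖ ^ 2 + (τ + s) * (1 - τ) * β ^ 2 * ‖q‖ ^ 2) := by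
    rw [norm_sub_sq_real, norm_smul, mul_pow, Real.norm_eq_abs, sq_abs, real_inner_smul_right,
      real_inner_comm, dualForm]
    field_simp
    ring
  rw [h]
  have : 0 ≤ 1 - τ := by linarith
  positivity

theorem exists_dualForm_le (β τ s : ℝ) :
    ∃ C : ℝ, 0 ≤ C ∧ ∀ q l : E, dualForm β τ s q l ≤ C * (‖q‖ ^ 2 + ‖l‖ ^ 2) := by
  set a := |(1 - τ * s / (τ + s)) * β|
  set b := |2 * τ / (τ + s)|
  set c := |1 / (β * (τ + s))|
  refine ⟨a + b + c, by positivity, fun q l => ?_⟩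
  have h1 : (1 - τ * s / (τ + s)) * β * ‖q‖ ^ 2 ≤ a * ‖q‖ ^ 2 := by gcongr; exact le_abs_self _
  have h3 : 1 / (β * (τ + s)) * ‖l‖ ^ 2 ≤ c * ‖l‖ ^ 2 := by gcongr; exact le_abs_self _
  have h2 : -(2 * τ / (τ + s) * inner ℝ q l) ≤ b * (‖q‖ ^ 2 + ‖l‖ ^ 2) := by
    calc -(2 * τ / (τ + s) * inner ℝ q l) ≤ |2 * τ / (τ + s) * inner ℝ q l| := neg_le_abs _
      _ = b * |inner ℝ q l| := abs_mul _ _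
      _ ≤ b * (‖q‖ * ‖l‖) := by gcongr; exact abs_real_inner_le_norm q l
      _ ≤ b * (‖q‖ ^ 2 + ‖l‖ ^ 2) := by
        gcongr; nlinarith [sq_nonneg (‖q‖ - ‖l‖), sq_nonneg ‖q‖, sq_nonneg ‖l‖]
  have ha : 0 ≤ a := abs_nonneg _
  have hb : 0 ≤ b := abs_nonneg _
  have hc : 0 ≤ c := abs_nonneg _
  rw [dualForm]
  have hq := sq_nonneg ‖q‖
  have hl := sq_nonneg ‖l‖
  nlinarith [mul_nonneg ha hq, mul_nonneg ha hl, mul_nonneg hb hq, mul_nonneg hb hl,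
    mul_nonneg hc hq, mul_nonneg hc hl]

/-- In the application q = B(y - y*), l is the multiplier error, p = Ax' + By - b is the mixed
residual and v = B(y' - y). Then p + v is the new residual, and the second `dualForm` is evaluated
at the updated q and l. -/
theorem dualForm_identity {β τ s : ℝ} (hβ : 0 < β) (hts : 0 < τ + s) (q l p v : E) :
    inner ℝ (l - β • p) (p + v) - β * inner ℝ (q + v) (τ • p + v)
      = dualForm β τ s q l - dualForm β τ s (q + v) (l - β • ((τ + s) • p + s • v))
        - β / 2 * ((2 - τ - s) * ‖p + v‖ ^ 2 - 2 * (1 - τ) * inner ℝ v (p + v)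
          + (1 - τ) * ‖v‖ ^ 2) := by
  simp only [dualForm, ← real_inner_self_eq_norm_sq]
  simp only [inner_add_left, inner_add_right, inner_sub_left, inner_sub_right,
    real_inner_smul_left, real_inner_smul_right]
  rw [real_inner_comm p v, real_inner_comm q v, real_inner_comm l v, real_inner_comm l p,
    real_inner_comm p q, real_inner_comm l q]
  field_simp
  ring

/-- The polynomial of Δ is (1+τ)(1+s) - (τ+s)². If τ ≤ -1 then s > 1, so the product is nonpositive
while the square is positive. -/
theorem neg_one_lt_of_mem_Delta {τ s : ℝ} (hΔ : (τ, s) ∈ Delta) : 0 < 1 + τ := by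
  obtain ⟨h1, h2, h3⟩ := hΔ
  simp only at h1 h2 h3
  by_contra! h
  nlinarith [mul_nonneg (neg_nonneg.2 h) (neg_nonneg.2 h), mul_nonneg (neg_nonneg.2 h) h1.le,
    sq_nonneg (τ + s)]

/-- The cross term ⟨v, p + v⟩ of `dualForm_identity` has no sign, and the monotonicity estimate
`hmono` trades it for ⟨v, r₀⟩ with the previous residual r₀. After multiplication by 1 + τ the
v-terms complete to ‖(1-τ)v - (1-s)r₀‖², at the price of the telescoping terms in ‖r₀‖² and w₀. -/
theorem dual_step {β τ s : ℝ} (hβ : 0 < β) (hΔ : (τ, s) ∈ Delta) (q l p v r₀ : E) {w w₀ : ℝ}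
    (hmono : β * ((1 + τ) * inner ℝ v (p + v) - τ * ‖v‖ ^ 2 - (1 - s) * inner ℝ v r₀)
      + (w - w₀) / 2 ≤ 0) :
    inner ℝ (l - β • p) (p + v) - β * inner ℝ (q + v) (τ • p + v)
      ≤ dualForm β τ s q l - dualForm β τ s (q + v) (l - β • ((τ + s) • p + s • v))
        + β / 2 * ((1 - s) ^ 2 / (1 + τ)) * (‖r₀‖ ^ 2 - ‖p + v‖ ^ 2)
        + (1 - τ) / (1 + τ) / 2 * (w₀ - w) := by
  have hτ := neg_one_lt_of_mem_Delta hΔ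
  obtain ⟨h1, h2, h3⟩ := hΔ
  simp only at h1 h2 h3
  rw [dualForm_identity hβ h1]
  set R := ‖p + v‖ ^ 2
  set i := inner ℝ v (p + v)
  suffices -(β / 2 * ((2 - τ - s) * R - 2 * (1 - τ) * i + (1 - τ) * ‖v‖ ^ 2))
      ≤ β / 2 * ((1 - s) ^ 2 / (1 + τ)) * (‖r₀‖ ^ 2 - R) + (1 - τ) / (1 + τ) / 2 * (w₀ - w) by
    linarith
  have hsq : 0 ≤ ‖(1 - τ) • v - (1 - s) • r₀‖ ^ 2 := sq_nonneg _
  rw [norm_sub_sq_real, norm_smul, norm_smul, mul_pow, mul_pow, Real.norm_eq_abs, sq_abs,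
    Real.norm_eq_abs, sq_abs, real_inner_smul_left, real_inner_smul_right] at hsq
  have hm := mul_le_mul_of_nonneg_left hmono (sub_nonneg.2 h2)
  have hR : 0 ≤ R := sq_nonneg _
  -- The bracket expands to the defining polynomial of Δ.
  have hc : 0 ≤ β / 2 * R * ((1 + τ) * (2 - τ - s) - (1 - s) ^ 2) :=
    mul_nonneg (by positivity) (by nlinarith)
  have hs := mul_nonneg (by positivity : 0 ≤ β / 2) hsq
  have e : β / 2 * ((1 - s) ^ 2 / (1 + τ)) * (‖r₀‖ ^ 2 - R) + (1 - τ) / (1 + τ) / 2 * (w₀ - w)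
      = (β / 2 * (1 - s) ^ 2 * (‖r₀‖ ^ 2 - R) + (1 - τ) / 2 * (w₀ - w)) / (1 + τ) := by
    field_simp
  rw [e, le_div_iff₀ hτ]
  linarith

end DualAlgebra

/-! ### Pathwise estimates for one outer iteration. -/

namespace Trajectory

variable {n n₁ n₂ N : ℕ} {Ω : Type*} {Z : Trajectory n n₁ n₂ N Ω} {P : Problem n n₁ n₂ N}
  {S : Params n₁ n₂} {ω : Ω}

theorem Updates.M_eq (Z : Trajectory n n₁ n₂ N Ω) (P : Problem n n₁ n₂ N) (S : Params n₁ n₂)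
    (k : ℕ) (ω : Ω) : Z.M k ω = Z.D P S k ω + S.β • (P.Aᵀ * P.A) := by
  rw [D, sub_add_cancel]

theorem Updates.M_psd (hU : Z.Updates P S ω) (hβ : 0 < S.β) (k : ℕ) :
    (Z.M k ω).PosSemidef := by
  rw [Updates.M_eq Z P S]
  refine (hU.D_psd k).add (Matrix.PosSemidef.smul ?_ hβ.le)
  have := Matrix.posSemidef_conjTranspose_mul_self P.A
  rwa [Matrix.conjTranspose_eq_transpose_of_trivial] at this

theorem two_div_mem {t : ℕ} (ht : 1 ≤ t) :
    (0 : ℝ) ≤ 2 / ((t : ℝ) + 1) ∧ (0 : ℝ) ≤ 1 - 2 / ((t : ℝ) + 1) := by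
  have : (1 : ℝ) ≤ t := by exact_mod_cast ht
  refine ⟨by positivity, ?_⟩
  rw [sub_nonneg, div_le_one (by linarith)]
  linarith

theorem Updates.inner_mem (hP : P.Standing) (hU : Z.Updates P S ω) {k : ℕ}
    (hx : Z.x k ω ∈ P.X) (hxb : Z.xb k ω ∈ P.X) {t : ℕ} (ht : t ≤ S.m k) :
    Z.xin k (t + 1) ω ∈ P.X ∧ Z.xbin k (t + 1) ω ∈ P.X := by
  induction t with
  | zero => exact ⟨by rw [zero_add, hU.xin_one]; exact hx, by rw [zero_add, hU.xbin_one]; exact hxb⟩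
  | succ t ih =>
    have hmem : t + 1 ∈ Finset.Icc 1 (S.m k) := Finset.mem_Icc.2 ⟨by omega, ht⟩
    have hb := (hU.xbin_succ k (t + 1) hmem).1
    refine ⟨?_, hb⟩
    rw [hU.xin_succ k (t + 1) hmem]
    obtain ⟨h0, h1⟩ := two_div_mem (t := t + 1) (by omega)
    exact hP.convex_X hb (ih (by omega)).1 h0 h1 (by ring)

theorem Updates.mem_X (hP : P.Standing) (hU : Z.Updates P S ω) (h0 : Z.x 0 ω ∈ P.X) (k : ℕ) :
    Z.x k ω ∈ P.X ∧ Z.xb k ω ∈ P.X := by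
  induction k with
  | zero => exact ⟨h0, hU.xb_zero ▸ h0⟩
  | succ k ih =>
    rw [hU.x_succ, hU.xb_succ]
    exact hU.inner_mem hP ih.1 ih.2 le_rfl

theorem Updates.xin_mem (hP : P.Standing) (hU : Z.Updates P S ω) (h0 : Z.x 0 ω ∈ P.X) {k t : ℕ}
    (ht : t ∈ Finset.Icc 1 (S.m k)) : Z.xin k t ω ∈ P.X ∧ Z.xbin k t ω ∈ P.X := by
  obtain ⟨h1, h2⟩ := Finset.mem_Icc.1 ht
  obtain ⟨u, rfl⟩ : ∃ u, t = u + 1 := ⟨t - 1, by omega⟩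
  exact hU.inner_mem hP (hU.mem_X hP h0 k).1 (hU.mem_X hP h0 k).2 (by omega)

theorem Updates.xhat_mem (hP : P.Standing) (hU : Z.Updates P S ω) (h0 : Z.x 0 ω ∈ P.X) {k t : ℕ}
    (ht : t ∈ Finset.Icc 1 (S.m k)) : Z.xhat k t ω ∈ P.X := by
  obtain ⟨ha, hb⟩ := two_div_mem (Finset.mem_Icc.1 ht).1
  exact hP.convex_X (hU.xin_mem hP h0 ht).2 (hU.xin_mem hP h0 ht).1 ha hb (by ring)

variable (Z) in
/-- The optimality gap of the `x`-subproblem of outer iteration `k` against the point `x`. -/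
noncomputable def gap (P : Problem n n₁ n₂ N) (S : Params n₁ n₂) (x : Vec n₁) (k : ℕ) (ω : Ω) : ℝ :=
  P.f (Z.x (k + 1) ω) - P.f x
    + inner ℝ (Z.h P S k ω + act (Z.M k ω) (Z.x (k + 1) ω - Z.x k ω)) (Z.x (k + 1) ω - x)

variable (Z) in
/-- The contribution of the gradient errors to the gap of outer iteration `k`. -/
noncomputable def noise (P : Problem n n₁ n₂ N) (S : Params n₁ n₂) (x : Vec n₁) (k : ℕ) (ω : Ω) :
    ℝ :=
  2 / ((S.m k : ℝ) * (S.m k + 1)) * ∑ t ∈ Finset.Icc 1 (S.m k),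
    ((t : ℝ) * inner ℝ (Z.δ P k t ω) (Z.xbin k t ω - x)
      + S.η k / 2 * ((t : ℝ) ^ 2 * sqNormW S.H⁻¹ (Z.δ P k t ω)))

/-- Telescoping `accelerated_step`: the weight t(t+1)/2 after step t is the weight before step t +
1, and before step 1 it is 0, so the initial gap drops out. Dividing by the last weight m_k(m_k+1)/2
gives the claim. -/
theorem Updates.gap_le (hP : P.Standing) (hU : Z.Updates P S ω) (h0 : Z.x 0 ω ∈ P.X)
    (hβ : 0 < S.β) (hH : S.H.PosDef) {ν : ℝ} (hν : 0 < ν) (hLip : P.GradLipschitz S.H ν)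
    {k : ℕ} (hm : 0 < S.m k) (hη0 : 0 < S.η k) (hη : S.η k ≤ 1 / (2 * ν)) {x : Vec n₁}
    (hx : x ∈ P.X) :
    Z.gap P S x k ω ≤ 2 / ((S.m k : ℝ) * (S.m k + 1) * S.η k)
      * (sqNormW S.H (Z.xb k ω - x) - sqNormW S.H (Z.xb (k + 1) ω - x)) + Z.noise P S x k ω := by
  have key : ∀ j ≤ S.m k, (j : ℝ) * (j + 1) / 2 * (P.f (Z.xin k (j + 1) ω) - P.f x
      + inner ℝ (Z.h P S k ω + act (Z.M k ω) (Z.xin k (j + 1) ω - Z.x k ω))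
        (Z.xin k (j + 1) ω - x))
      ≤ 1 / S.η k * (sqNormW S.H (Z.xb k ω - x) - sqNormW S.H (Z.xbin k (j + 1) ω - x))
        + ∑ t ∈ Finset.Icc 1 j, ((t : ℝ) * inner ℝ (Z.δ P k t ω) (Z.xbin k t ω - x)
          + S.η k / 2 * ((t : ℝ) ^ 2 * sqNormW S.H⁻¹ (Z.δ P k t ω))) := by
    intro j hj
    induction j with
    | zero => simp [hU.xbin_one]
    | succ j ih =>
      have hmem : j + 1 ∈ Finset.Icc 1 (S.m k) := Finset.mem_Icc.2 ⟨by omega, hj⟩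
      have hin := hU.xin_mem hP h0 hmem
      have hs := hU.xbin_succ k (j + 1) hmem
      have step := accelerated_step hP hH (hU.M_psd hβ k) hν hLip hη0 hη
        (t := ((j + 1 : ℕ) : ℝ)) (by push_cast; have : (0 : ℝ) ≤ j := by positivity
                                     linarith) hx hin.2 hin.1 hs.1
        (xhat := Z.xhat k (j + 1) ω) rfl (hU.xin_succ k (j + 1) hmem) hs.2
      rw [Finset.sum_Icc_succ_top (by omega)]
      have ih' := ih (by omega)
      have e : (((j + 1 : ℕ) : ℝ) - 1) * ((j + 1 : ℕ) : ℝ) / 2 = (j : ℝ) * (j + 1) / 2 := by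
        push_cast; ring
      rw [e] at step
      unfold δ at ih' ⊢
      linarith
  have hk := key _ le_rfl
  rw [← hU.x_succ, ← hU.xb_succ] at hk
  have hmr : (0 : ℝ) < S.m k := by exact_mod_cast hm
  have h2 := mul_le_mul_of_nonneg_left hk
    (by positivity : (0 : ℝ) ≤ 2 / ((S.m k : ℝ) * (S.m k + 1)))
  rw [← mul_assoc, mul_add _ (1 / S.η k * _), ← mul_assoc _ (1 / S.η k)] at h2
  have e1 : 2 / ((S.m k : ℝ) * (S.m k + 1)) * ((S.m k : ℝ) * (S.m k + 1) / 2) = 1 := by field_simp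
  have e2 : 2 / ((S.m k : ℝ) * (S.m k + 1)) * (1 / S.η k)
      = 2 / ((S.m k : ℝ) * (S.m k + 1) * S.η k) := by field_simp
  rw [e1, e2, one_mul] at h2
  exact h2

theorem Updates.y_opt (hP : P.Standing) (hL : S.L.PosSemidef) (hU : Z.Updates P S ω) (k : ℕ) :
    Z.y (k + 1) ω ∈ P.dom ∧ ∀ y ∈ P.dom,
      P.gReal (Z.y (k + 1) ω) - P.gReal y
        + inner ℝ (-Z.lamHalf k ω + S.β • P.resid (Z.x (k + 1) ω) (Z.y (k + 1) ω))
          (act P.B (Z.y (k + 1) ω - y))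
        + inner ℝ (Z.y (k + 1) ω - y) (act S.L (Z.y (k + 1) ω - Z.y k ω)) ≤ 0 :=
  hP.y_optimality hL.isHermitian (hU.y_succ k).1 (hU.y_succ k).2

variable (Z) in
/-- The Lyapunov function of the outer iteration (for `k ≥ 1`). -/
noncomputable def potential (P : Problem n n₁ n₂ N) (S : Params n₁ n₂) (x : Vec n₁) (y : Vec n₂)
    (l : Vec n) (k : ℕ) (ω : Ω) : ℝ :=
  dualForm S.β S.τ S.s (act P.B (Z.y k ω - y)) (Z.lam k ω - l)
    + 1 / 2 * sqNormW S.L (Z.y k ω - y)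
    + 1 / 2 * sqNormW (Z.D P S k ω) (Z.x k ω - x)
    + S.β / 2 * ((1 - S.s) ^ 2 / (1 + S.τ)) * ‖P.resid (Z.x k ω) (Z.y k ω)‖ ^ 2
    + (1 - S.τ) / (1 + S.τ) / 2 * sqNormW S.L (Z.y k ω - Z.y (k - 1) ω)

theorem Updates.potential_nonneg (hU : Z.Updates P S ω) (hβ : 0 < S.β) (hL : S.L.PosSemidef)
    (hΔ : (S.τ, S.s) ∈ Delta) (x : Vec n₁) (y : Vec n₂) (l : Vec n) (k : ℕ) :
    0 ≤ Z.potential P S x y l k ω := by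
  have hτ := neg_one_lt_of_mem_Delta hΔ
  have hτ1 : 0 ≤ 1 - S.τ := by have := hΔ.2.1; simp only at this; linarith
  have h1 := dualForm_nonneg hβ hΔ (act P.B (Z.y k ω - y)) (Z.lam k ω - l)
  have h2 := sqNormW_nonneg hL (Z.y k ω - y)
  have h3 := sqNormW_nonneg (hU.D_psd k) (Z.x k ω - x)
  have h4 := sqNormW_nonneg hL (Z.y k ω - Z.y (k - 1) ω)
  unfold potential
  positivity

/-- Monotonicity of the `y`-steps: the optimality conditions of two consecutive `y`-subproblems
tested against each other. -/
theorem Updates.y_monotone (hP : P.Standing) (hL : S.L.PosSemidef) (hU : Z.Updates P S ω) (k : ℕ) :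
    S.β * ((1 + S.τ) * inner ℝ (act P.B (Z.y (k + 1 + 1) ω - Z.y (k + 1) ω))
          (P.resid (Z.x (k + 1 + 1) ω) (Z.y (k + 1 + 1) ω))
        - S.τ * ‖act P.B (Z.y (k + 1 + 1) ω - Z.y (k + 1) ω)‖ ^ 2
        - (1 - S.s) * inner ℝ (act P.B (Z.y (k + 1 + 1) ω - Z.y (k + 1) ω))
          (P.resid (Z.x (k + 1) ω) (Z.y (k + 1) ω)))
      + (sqNormW S.L (Z.y (k + 1 + 1) ω - Z.y (k + 1) ω)
        - sqNormW S.L (Z.y (k + 1) ω - Z.y k ω)) / 2 ≤ 0 := by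
  have o1 := hU.y_opt hP hL k
  have o2 := hU.y_opt hP hL (k + 1)
  have h1 := o1.2 _ o2.1
  have h2 := o2.2 _ o1.1
  have hlam := hU.lam_succ k
  have hhalf := hU.lamHalf_eq (k + 1)
  have hres : P.resid (Z.x (k + 1 + 1) ω) (Z.y (k + 1) ω)
      = P.resid (Z.x (k + 1 + 1) ω) (Z.y (k + 1 + 1) ω)
        - act P.B (Z.y (k + 1 + 1) ω - Z.y (k + 1) ω) := by
    simp only [Problem.resid, act_sub]; abel
  rw [hres] at hhalf
  have hy := two_mul_inner_act_le hL (Z.y (k + 1 + 1) ω - Z.y (k + 1) ω) (Z.y (k + 1) ω - Z.y k ω)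
  have hneg : Z.y (k + 1) ω - Z.y (k + 1 + 1) ω = -(Z.y (k + 1 + 1) ω - Z.y (k + 1) ω) := by abel
  rw [hneg, act_neg, inner_neg_right, inner_neg_left] at h1
  -- Both half-step multipliers are written in terms of the same λ between the two `y`-steps, which
  -- then cancels when the two conditions are added.
  have hh : Z.lamHalf k ω = Z.lam (k + 1) ω
      + (S.s * S.β) • P.resid (Z.x (k + 1) ω) (Z.y (k + 1) ω) := by rw [hlam]; abel
  rw [hh] at h1
  rw [hhalf] at h2
  set v := act P.B (Z.y (k + 1 + 1) ω - Z.y (k + 1) ω)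
  set r := P.resid (Z.x (k + 1 + 1) ω) (Z.y (k + 1 + 1) ω)
  set r₀ := P.resid (Z.x (k + 1) ω) (Z.y (k + 1) ω)
  have hsq : inner ℝ (Z.y (k + 1 + 1) ω - Z.y (k + 1) ω)
      (act S.L (Z.y (k + 1 + 1) ω - Z.y (k + 1) ω))
      = sqNormW S.L (Z.y (k + 1 + 1) ω - Z.y (k + 1) ω) := rfl
  rw [hsq] at h2
  rw [inner_sub_left] at hy
  simp only [inner_add_left, inner_sub_left, inner_neg_left, real_inner_smul_left,
    real_inner_self_eq_norm_sq] at h1 h2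
  rw [real_inner_comm v r, real_inner_comm v r₀] at *
  linarith

/-- One outer iteration decreases the Lyapunov function up to the gap of the `x`-subproblem. -/
theorem Updates.outer_step (hP : P.Standing) (hβ : 0 < S.β) (hL : S.L.PosSemidef)
    (hΔ : (S.τ, S.s) ∈ Delta) (hU : Z.Updates P S ω) {k : ℕ} (hk : 0 < k)
    (hD : (Z.D P S k ω - Z.D P S (k + 1) ω).PosSemidef) {xs : Vec n₁} {ys : Vec n₂}
    (hys : ys ∈ P.dom) (hr : P.resid xs ys = 0) (l : Vec n) :
    P.f (Z.x (k + 1) ω) + P.gReal (Z.y (k + 1) ω) - (P.f xs + P.gReal ys)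
        - inner ℝ l (P.resid (Z.x (k + 1) ω) (Z.y (k + 1) ω))
      ≤ Z.potential P S xs ys l k ω - Z.potential P S xs ys l (k + 1) ω + Z.gap P S xs k ω := by
  -- Monotonicity needs the current y to be itself a minimizer, which fails for the arbitrary
  -- starting point y⁰; hence k ≥ 1.
  obtain ⟨k, rfl⟩ : ∃ j, k = j + 1 := ⟨k - 1, by omega⟩
  have hmono := hU.y_monotone hP hL k
  have hyopt := (hU.y_opt hP hL (k + 1)).2 ys hys
  unfold potential gap
  simp only [Nat.add_sub_cancel]
  set x := Z.x (k + 1) ω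
  set x' := Z.x (k + 1 + 1) ω
  set y := Z.y (k + 1) ω
  set y' := Z.y (k + 1 + 1) ω
  set p := P.resid x' y with hp
  set v := act P.B (y' - y) with hv
  set q := act P.B (y - ys) with hq
  set a := act P.A (x' - xs) with ha
  have hr' : P.resid x' y' = p + v := by
    simp only [hp, hv, Problem.resid, act_sub]; abel
  have hpa : p = a + q := by
    rw [hp, Problem.resid_eq x' xs y ys, hr, zero_add]
  have hq' : act P.B (y' - ys) = q + v := by simp only [hq, hv, act_sub]; abel
  have hlam' : Z.lam (k + 1 + 1) ω - l
      = (Z.lam (k + 1) ω - l) - S.β • ((S.τ + S.s) • p + S.s • v) := by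
    rw [hU.lam_succ, hU.lamHalf_eq, hr']; module
  rw [hr'] at hmono
  have hdual := dual_step hβ hΔ q (Z.lam (k + 1) ω - l) p v (P.resid x y) hmono
  rw [hr', hq', hlam']
  rw [hU.lamHalf_eq, hr', hq'] at hyopt
  -- The part βAᵀA of M turns the old residual inside h into the mixed residual p and leaves D as
  -- the proximal matrix.
  have hx1 : inner ℝ (Z.h P S (k + 1) ω + act (Z.M (k + 1) ω) (x' - x)) (x' - xs)
      = -inner ℝ (Z.lam (k + 1) ω - S.β • p) a
        + inner ℝ (x' - xs) (act (Z.D P S (k + 1) ω) (x' - x)) := by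
    have e : Z.h P S (k + 1) ω + act (Z.M (k + 1) ω) (x' - x)
        = -act P.Aᵀ (Z.lam (k + 1) ω - S.β • p) + act (Z.D P S (k + 1) ω) (x' - x) := by
      rw [Updates.M_eq Z P S, add_act, smul_act, mul_act, h]
      have : p = P.resid x y + act P.A (x' - x) := by
        simp only [hp, Problem.resid, act_sub]; abel
      rw [this]
      simp only [act_sub, act_smul, act_add, smul_add, smul_sub]
      abel
    rw [e, inner_add_left, inner_neg_left, inner_transpose_act,
      real_inner_comm (x' - xs) (act _ _)]
  have hDs := sqNormW_add (hU.D_psd (k + 1)).isHermitian (x' - xs) (x - x')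
  rw [sub_add_sub_comm, show x' + x - (xs + x') = x - xs by abel] at hDs
  have hDn : inner ℝ (x' - xs) (act (Z.D P S (k + 1) ω) (x - x'))
      = -inner ℝ (x' - xs) (act (Z.D P S (k + 1) ω) (x' - x)) := by
    rw [← inner_neg_right, ← act_neg, neg_sub]
  have hD0 := sqNormW_nonneg (hU.D_psd (k + 1)) (x - x')
  have hDm := sqNormW_nonneg hD (x' - xs)
  have hDm' : sqNormW (Z.D P S (k + 1) ω - Z.D P S (k + 1 + 1) ω) (x' - xs)
      = sqNormW (Z.D P S (k + 1) ω) (x' - xs) - sqNormW (Z.D P S (k + 1 + 1) ω) (x' - xs) := by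
    simp only [sqNormW, sub_act, inner_sub_right]
  have hLs := sqNormW_add hL.isHermitian (y' - ys) (y - y')
  rw [sub_add_sub_comm, show y' + y - (ys + y') = y - ys by abel] at hLs
  have hLn : inner ℝ (y' - ys) (act S.L (y - y')) = -inner ℝ (y' - ys) (act S.L (y' - y)) := by
    rw [← inner_neg_right, ← act_neg, neg_sub]
  have hL0 := sqNormW_nonneg hL (y - y')
  -- By feasibility of (x*, y*), a = p - q; so the multiplier terms of the `x`- and `y`-conditions
  -- add up to the left side of `dual_step`.
  have hfin : inner ℝ (Z.lam (k + 1) ω - S.β • p) a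
      - inner ℝ (-(Z.lam (k + 1) ω - (S.τ * S.β) • p) + S.β • (p + v)) (q + v)
      - inner ℝ l (p + v)
      = inner ℝ (Z.lam (k + 1) ω - l - S.β • p) (p + v)
        - S.β * inner ℝ (q + v) (S.τ • p + v) := by
    have : a = p - q := by rw [hpa]; abel
    rw [this]
    simp only [inner_add_left, inner_add_right, inner_sub_left, inner_sub_right, inner_neg_left,
      real_inner_smul_left, real_inner_smul_right]
    rw [real_inner_comm q p, real_inner_comm q v, real_inner_comm v p]
    ring
  rw [hx1]
  linarith

theorem sqNormW_D_le (hβ : 0 < S.β) {k : ℕ} {ω : Ω} {R : ℝ}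
    (hR : (R • (1 : Matrix (Fin n₁) (Fin n₁) ℝ) - Z.M k ω).PosSemidef) (v : Vec n₁) :
    sqNormW (Z.D P S k ω) v ≤ R * ‖v‖ ^ 2 := by
  have h1 := sqNormW_nonneg hR v
  have e1 : sqNormW (R • (1 : Matrix (Fin n₁) (Fin n₁) ℝ) - Z.M k ω) v
      = R * ‖v‖ ^ 2 - sqNormW (Z.M k ω) v := by
    rw [← real_inner_self_eq_norm_sq]
    simp only [sqNormW, sub_act, smul_act, one_act, inner_sub_right, real_inner_smul_right]
  have e2 : sqNormW (Z.D P S k ω) v = sqNormW (Z.M k ω) v - S.β * ‖act P.A v‖ ^ 2 := by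
    rw [← real_inner_self_eq_norm_sq]
    simp only [D, sqNormW, sub_act, smul_act, mul_act, inner_sub_right, real_inner_smul_right]
    rw [real_inner_comm (act P.Aᵀ (act P.A v)) v, inner_transpose_act]
  have : 0 ≤ S.β * ‖act P.A v‖ ^ 2 := by positivity
  linarith

end Trajectory

/-! ### The pathwise ergodic estimate. -/

/-- A vector of norm at most `ρ` that attains `-ρ ‖r‖` against `r`. -/
theorem exists_inner_eq_neg_mul_norm {E : Type*} [NormedAddCommGroup E] [InnerProductSpace ℝ E]
    {ρ : ℝ} (hρ : 0 ≤ ρ) (r : E) : ∃ l : E, ‖l‖ ≤ ρ ∧ inner ℝ l r = -(ρ * ‖r‖) := by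
  rcases eq_or_ne r 0 with rfl | hr
  · exact ⟨0, by simpa using hρ, by simp⟩
  · have h : ‖r‖ ≠ 0 := norm_ne_zero_iff.2 hr
    refine ⟨(-(ρ * ‖r‖⁻¹)) • r, ?_, ?_⟩
    · rw [norm_smul, norm_neg, Real.norm_of_nonneg (by positivity), mul_assoc, inv_mul_cancel₀ h,
        mul_one]
    · rw [real_inner_smul_left, real_inner_self_eq_norm_sq]; field_simp

/-- The weight of the telescoping distance term in outer iteration `k`. -/
noncomputable def Params.weight {n₁ n₂ : ℕ} (S : Params n₁ n₂) (k : ℕ) : ℝ :=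
  2 / ((S.m k : ℝ) * (S.m k + 1) * S.η k)

namespace Trajectory

variable {n n₁ n₂ N : ℕ} {Ω : Type*} {Z : Trajectory n n₁ n₂ N Ω} {P : Problem n n₁ n₂ N}
  {S : Params n₁ n₂} {ω : Ω}

/-- Potential and weighted distance both telescope, the latter because the weights decrease; the
final ones are nonnegative and are dropped. The multiplier l stays free, so it may later depend on
the averages. -/
theorem Updates.sum_le (hP : P.Standing) (hU : Z.Updates P S ω) (h0 : Z.x 0 ω ∈ P.X)
    (hβ : 0 < S.β) (hH : S.H.PosDef) (hL : S.L.PosSemidef) (hΔ : (S.τ, S.s) ∈ Delta)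
    {ν : ℝ} (hν : 0 < ν) (hLip : P.GradLipschitz S.H ν)
    (hm : ∀ k, 0 < S.m k) (hη0 : ∀ k, 0 < S.η k) (hθ : Antitone S.weight)
    {κ : ℕ} (hκ : 0 < κ) (hη : ∀ k ≥ κ, S.η k ≤ 1 / (2 * ν))
    (hD : ∀ k ≥ κ, (Z.D P S k ω - Z.D P S (k + 1) ω).PosSemidef)
    {xs : Vec n₁} {ys : Vec n₂} {ls : Vec n} (hw : P.IsSaddlePoint xs ys ls) (l : Vec n) (T : ℕ) :
    ∑ k ∈ Finset.Icc κ (κ + T), (P.f (Z.x (k + 1) ω) + P.gReal (Z.y (k + 1) ω)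
        - (P.f xs + P.gReal ys) - inner ℝ l (P.resid (Z.x (k + 1) ω) (Z.y (k + 1) ω)))
      ≤ Z.potential P S xs ys l κ ω + S.weight κ * sqNormW S.H (Z.xb κ ω - xs)
        + ∑ k ∈ Finset.Icc κ (κ + T), Z.noise P S xs k ω := by
  have step : ∀ k ≥ κ, P.f (Z.x (k + 1) ω) + P.gReal (Z.y (k + 1) ω)
        - (P.f xs + P.gReal ys) - inner ℝ l (P.resid (Z.x (k + 1) ω) (Z.y (k + 1) ω))
      ≤ (Z.potential P S xs ys l k ω + S.weight k * sqNormW S.H (Z.xb k ω - xs))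
        - (Z.potential P S xs ys l (k + 1) ω
          + S.weight (k + 1) * sqNormW S.H (Z.xb (k + 1) ω - xs))
        + Z.noise P S xs k ω := fun k hk => by
    have h1 := hU.outer_step hP hβ hL hΔ (hκ.trans_le hk) (hD k hk) (hw.mem_dom hP)
      (hw.resid_eq_zero hP) l
    have h2 := hU.gap_le hP h0 hβ hH hν hLip (hm k) (hη0 k) (hη k hk) hw.mem_X
    have h3 := mul_le_mul_of_nonneg_right (hθ (Nat.le_succ k))
      (sqNormW_nonneg hH.posSemidef (Z.xb (k + 1) ω - xs))
    rw [← Params.weight] at h2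
    simp only [Nat.succ_eq_add_one] at h3
    linarith
  have key : ∑ k ∈ Finset.Icc κ (κ + T), (P.f (Z.x (k + 1) ω) + P.gReal (Z.y (k + 1) ω)
        - (P.f xs + P.gReal ys) - inner ℝ l (P.resid (Z.x (k + 1) ω) (Z.y (k + 1) ω)))
      ≤ (Z.potential P S xs ys l κ ω + S.weight κ * sqNormW S.H (Z.xb κ ω - xs))
        - (Z.potential P S xs ys l (κ + T + 1) ω
          + S.weight (κ + T + 1) * sqNormW S.H (Z.xb (κ + T + 1) ω - xs))
        + ∑ k ∈ Finset.Icc κ (κ + T), Z.noise P S xs k ω := by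
    induction T with
    | zero => simpa using step κ le_rfl
    | succ T ih =>
      rw [← add_assoc, Finset.sum_Icc_succ_top (by omega), Finset.sum_Icc_succ_top (by omega)]
      have := step (κ + T + 1) (by omega)
      linarith
  have h1 := hU.potential_nonneg hβ hL hΔ xs ys l (κ + T + 1)
  have h2 : 0 ≤ S.weight (κ + T + 1) * sqNormW S.H (Z.xb (κ + T + 1) ω - xs) := by
    refine mul_nonneg ?_ (sqNormW_nonneg hH.posSemidef _)
    have := hη0 (κ + T + 1)
    unfold Params.weight
    positivity
  linarith

theorem card_weight (κ T : ℕ) :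
    ∑ _k ∈ Finset.Icc κ (κ + T), (1 / ((T : ℝ) + 1)) = 1 := by
  rw [Finset.sum_const, Nat.card_Icc, nsmul_eq_mul, show κ + T + 1 - κ = T + 1 by omega]
  push_cast
  field_simp

theorem Updates.xErg_mem (hP : P.Standing) (hU : Z.Updates P S ω) (h0 : Z.x 0 ω ∈ P.X) (κ T : ℕ) :
    Z.xErg κ T ω ∈ P.X := by
  rw [xErg, Finset.smul_sum]
  exact hP.convex_X.sum_mem (fun _ _ => by positivity) (card_weight κ T)
    fun k _ => (hU.mem_X hP h0 (k + 1)).1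

theorem Updates.yErg_mem (hP : P.Standing) (hL : S.L.PosSemidef) (hU : Z.Updates P S ω)
    (κ T : ℕ) : Z.yErg κ T ω ∈ P.dom := by
  rw [yErg, Finset.smul_sum]
  exact hP.convexOn_gReal.1.sum_mem (fun _ _ => by positivity) (card_weight κ T)
    fun k _ => (hU.y_opt hP hL k).1

theorem resid_erg (Z : Trajectory n n₁ n₂ N Ω) (P : Problem n n₁ n₂ N) (κ T : ℕ) (ω : Ω) :
    P.resid (Z.xErg κ T ω) (Z.yErg κ T ω)
      = (1 / ((T : ℝ) + 1)) • ∑ k ∈ Finset.Icc κ (κ + T),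
        P.resid (Z.x (k + 1) ω) (Z.y (k + 1) ω) := by
  have hb : P.b = (1 / ((T : ℝ) + 1)) • ∑ _k ∈ Finset.Icc κ (κ + T), P.b := by
    rw [Finset.smul_sum, ← Finset.sum_smul, card_weight, one_smul]
  simp only [Problem.resid, Finset.sum_add_distrib, Finset.sum_sub_distrib, smul_add, smul_sub]
  rw [← hb, xErg, yErg, act_smul, act_smul, act_sum, act_sum]

theorem Updates.objective_erg_le (hP : P.Standing) (hL : S.L.PosSemidef) (hU : Z.Updates P S ω)
    (h0 : Z.x 0 ω ∈ P.X) (κ T : ℕ) :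
    P.f (Z.xErg κ T ω) + P.gReal (Z.yErg κ T ω)
      ≤ 1 / ((T : ℝ) + 1) * ∑ k ∈ Finset.Icc κ (κ + T),
        (P.f (Z.x (k + 1) ω) + P.gReal (Z.y (k + 1) ω)) := by
  have h1 := hP.convexOn_f.map_sum_le (t := Finset.Icc κ (κ + T))
    (w := fun _ => 1 / ((T : ℝ) + 1)) (p := fun k => Z.x (k + 1) ω) (fun _ _ => by positivity)
    (card_weight κ T) fun k _ => (hU.mem_X hP h0 (k + 1)).1
  have h2 := hP.convexOn_gReal.map_sum_le (t := Finset.Icc κ (κ + T))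
    (w := fun _ => 1 / ((T : ℝ) + 1)) (p := fun k => Z.y (k + 1) ω) (fun _ _ => by positivity)
    (card_weight κ T) fun k _ => (hU.y_opt hP hL k).1
  simp only [smul_eq_mul] at h1 h2
  rw [← Finset.smul_sum, ← Finset.mul_sum] at h1 h2
  rw [Finset.sum_add_distrib, mul_add]
  exact add_le_add h1 h2

/-- The pathwise ergodic estimate. -/
theorem Updates.ergodic_le (hP : P.Standing) (hU : Z.Updates P S ω) (h0 : Z.x 0 ω ∈ P.X)
    (hβ : 0 < S.β) (hH : S.H.PosDef) (hL : S.L.PosSemidef) (hΔ : (S.τ, S.s) ∈ Delta)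
    {ν : ℝ} (hν : 0 < ν) (hLip : P.GradLipschitz S.H ν)
    (hm : ∀ k, 0 < S.m k) (hη0 : ∀ k, 0 < S.η k) (hθ : Antitone S.weight)
    {κ : ℕ} (hκ : 0 < κ) (hη : ∀ k ≥ κ, S.η k ≤ 1 / (2 * ν))
    (hD : ∀ k ≥ κ, (Z.D P S k ω - Z.D P S (k + 1) ω).PosSemidef)
    {xs : Vec n₁} {ys : Vec n₂} {ls : Vec n} (hw : P.IsSaddlePoint xs ys ls) {Φ : ℝ}
    (hΦ : ∀ l : Vec n, ‖l‖ ≤ ‖ls‖ + 1 → Z.potential P S xs ys l κ ω ≤ Φ) (T : ℕ) :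
    ‖P.resid (Z.xErg κ T ω) (Z.yErg κ T ω)‖
      ≤ 1 / ((T : ℝ) + 1) * (Φ + S.weight κ * sqNormW S.H (Z.xb κ ω - xs)
        + ∑ k ∈ Finset.Icc κ (κ + T), Z.noise P S xs k ω) ∧
    |P.f (Z.xErg κ T ω) + P.gReal (Z.yErg κ T ω) - (P.f xs + P.gReal ys)|
      ≤ (‖ls‖ + 1) * (1 / ((T : ℝ) + 1) * (Φ + S.weight κ * sqNormW S.H (Z.xb κ ω - xs)
        + ∑ k ∈ Finset.Icc κ (κ + T), Z.noise P S xs k ω)) := by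
  set r := P.resid (Z.xErg κ T ω) (Z.yErg κ T ω) with hr
  set W := 1 / ((T : ℝ) + 1) * (Φ + S.weight κ * sqNormW S.H (Z.xb κ ω - xs)
        + ∑ k ∈ Finset.Icc κ (κ + T), Z.noise P S xs k ω) with hW
  -- The radius exceeds ‖λ*‖ by 1: the saddle inequality costs at most ‖λ*‖‖r‖, so one full ‖r‖
  -- remains to be bounded by W.
  obtain ⟨l, hl, hlr⟩ := exists_inner_eq_neg_mul_norm
    (add_nonneg (norm_nonneg ls) zero_le_one) r
  have hsum := hU.sum_le hP h0 hβ hH hL hΔ hν hLip hm hη0 hθ hκ hη hD hw l T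
  have hobj := hU.objective_erg_le hP hL h0 κ T
  have hT : (0 : ℝ) ≤ 1 / ((T : ℝ) + 1) := by positivity
  have hupper : P.f (Z.xErg κ T ω) + P.gReal (Z.yErg κ T ω) - (P.f xs + P.gReal ys)
      + (‖ls‖ + 1) * ‖r‖ ≤ W := by
    have h1 := mul_le_mul_of_nonneg_left 
      (hsum.trans (add_le_add (add_le_add (hΦ l hl) le_rfl) le_rfl)) hT
    rw [← hW, Finset.sum_sub_distrib, Finset.sum_sub_distrib, mul_sub, mul_sub] at h1
    have e1 : 1 / ((T : ℝ) + 1) * ∑ _k ∈ Finset.Icc κ (κ + T), (P.f xs + P.gReal ys)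
        = P.f xs + P.gReal ys := by
      rw [Finset.mul_sum, ← Finset.sum_mul, card_weight, one_mul]
    have e2 : 1 / ((T : ℝ) + 1) * ∑ k ∈ Finset.Icc κ (κ + T),
        inner ℝ l (P.resid (Z.x (k + 1) ω) (Z.y (k + 1) ω)) = -((‖ls‖ + 1) * ‖r‖) := by
      rw [← hlr, hr, resid_erg, real_inner_smul_right, inner_sum]
    rw [e1, e2] at h1
    linarith
  have hlower := hw.add_le hP (hU.xErg_mem hP h0 κ T) (hU.yErg_mem hP hL κ T)
  rw [← hr] at hlower
  have hCS : -(‖ls‖ * ‖r‖) ≤ inner ℝ ls r := (abs_le.1 (abs_real_inner_le_norm ls r)).1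
  have hrW : ‖r‖ ≤ W := by linarith
  have hr0 := norm_nonneg r
  have hls := norm_nonneg ls
  refine ⟨hrW, abs_le.2 ⟨?_, ?_⟩⟩
  · nlinarith
  · nlinarith

end Trajectory

/-! ### Square integrability tools and averaging over the past. -/

section Integrability

variable {Ω : Type*} {mΩ : MeasurableSpace Ω} {μ : Measure Ω}

theorem memLp_act {p q : ℕ} (G : Matrix (Fin p) (Fin q) ℝ) {X : Ω → Vec q} (hX : MemLp X 2 μ) :
    MemLp (fun ω => act G (X ω)) 2 μ :=
  (LinearMap.toContinuousLinearMap (Matrix.toEuclideanLin G)).comp_memLp' hX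

theorem integrable_norm_sq_of_memLp {E : Type*} [NormedAddCommGroup E] {X : Ω → E}
    (hX : MemLp X 2 μ) : Integrable (fun ω => ‖X ω‖ ^ 2) μ :=
  (memLp_two_iff_integrable_sq_norm hX.1).1 hX

theorem integrable_inner_of_memLp {E : Type*} [NormedAddCommGroup E] [InnerProductSpace ℝ E]
    {X Y : Ω → E} (hX : MemLp X 2 μ) (hY : MemLp Y 2 μ) :
    Integrable (fun ω => inner ℝ (X ω) (Y ω)) μ := by
  refine ((integrable_norm_sq_of_memLp hX).add (integrable_norm_sq_of_memLp hY)).mono'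
    (hX.1.inner hY.1) (Eventually.of_forall fun ω => ?_)
  have := norm_inner_le_norm (𝕜 := ℝ) (X ω) (Y ω)
  simp only [Pi.add_apply]
  nlinarith [sq_nonneg (‖X ω‖ - ‖Y ω‖), sq_nonneg ‖X ω‖, sq_nonneg ‖Y ω‖]

theorem memLp_of_norm_sq_le {E : Type*} [NormedAddCommGroup E] {X : Ω → E} {g : Ω → ℝ}
    (hX : AEStronglyMeasurable X μ) (hg : Integrable g μ) (h : ∀ ω, ‖X ω‖ ^ 2 ≤ g ω) :
    MemLp X 2 μ := by
  refine (memLp_two_iff_integrable_sq_norm hX).2 (hg.mono' (hX.norm.pow 2)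
    (Eventually.of_forall fun ω => ?_))
  rw [Real.norm_of_nonneg (by positivity)]
  exact h ω

theorem integrable_sqNormW {q : ℕ} {G : Matrix (Fin q) (Fin q) ℝ} {X : Ω → Vec q}
    (hX : MemLp X 2 μ) : Integrable (fun ω => sqNormW G (X ω)) μ :=
  integrable_inner_of_memLp hX (memLp_act G hX)

/-- `fderiv` is Borel measurable even where φ is not differentiable, so the behaviour of the f_j
outside X does not matter. -/
theorem measurable_gradient {q : ℕ} (φ : Vec q → ℝ) : Measurable (gradient φ) :=
  (InnerProductSpace.toDual ℝ (Vec q)).symm.continuous.measurable.comp (measurable_fderiv ℝ φ)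

/-- An integrable vector with conditional mean zero is uncorrelated with the past. -/
theorem integral_inner_eq_zero_of_condExp [IsFiniteMeasure μ] {q : ℕ} {m : MeasurableSpace Ω}
    (hm : m ≤ mΩ) {e Y : Ω → Vec q} (he : Integrable e μ) (hmean : μ[e | m] =ᵐ[μ] 0)
    (hY : StronglyMeasurable[m] Y) (heY : Integrable (fun ω => inner ℝ (e ω) (Y ω)) μ) :
    ∫ ω, inner ℝ (e ω) (Y ω) ∂μ = 0 := by
  have h := condExp_bilin_of_stronglyMeasurable_right (m := m) (innerSL ℝ) (f := e) (g := Y) hY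
    heY he
  have h2 : ∫ ω, inner ℝ (e ω) (Y ω) ∂μ
      = ∫ ω, (μ[fun ω => (innerSL ℝ (e ω)) (Y ω) | m]) ω ∂μ := (integral_condExp hm).symm
  rw [h2, integral_congr_ae h, ← integral_zero Ω ℝ]
  refine integral_congr_ae ?_
  filter_upwards [hmean] with ω hω
  simp [hω]

/-- Averaging over a uniform index independent of the past. -/
theorem integral_uniform_index [IsFiniteMeasure μ] {N : ℕ} {m : MeasurableSpace Ω}
    {ξ : Ω → Fin N} (hξ : Measurable[mΩ] ξ) (hunif : ∀ j, μ.real {ω | ξ ω = j} = 1 / (N : ℝ))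
    (hind : Indep (MeasurableSpace.comap ξ inferInstance) m μ) {V : Fin N → Ω → ℝ}
    (hV : ∀ j, Measurable[m] (V j)) (hVi : ∀ j, Integrable (V j) μ) :
    ∫ ω, V (ξ ω) ω ∂μ = 1 / (N : ℝ) * ∑ j, ∫ ω, V j ω ∂μ := by
  set φ : Fin N → Fin N → ℝ := fun j i => if i = j then 1 else 0
  have hφ : ∀ j, Measurable (φ j) := fun j => measurable_of_finite _
  have hφξ : ∀ j, Measurable[mΩ] (fun ω => φ j (ξ ω)) := fun j => (hφ j).comp hξ
  have hsum : ∀ ω, V (ξ ω) ω = ∑ j, φ j (ξ ω) * V j ω := fun ω => by simp [φ]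
  have hint : ∀ j, Integrable (fun ω => φ j (ξ ω) * V j ω) μ := fun j => by
    refine (hVi j).norm.mono' ((hφξ j).aestronglyMeasurable.mul (hVi j).1)
      (Eventually.of_forall fun ω => ?_)
    simp only [φ]
    split_ifs <;> simp
  simp_rw [hsum]
  rw [integral_finsetSum _ fun j _ => hint j, Finset.mul_sum]
  refine Finset.sum_congr rfl fun j _ => ?_
  have hI : IndepFun ξ (V j) μ := by
    rw [IndepFun_iff_Indep]
    exact indep_of_indep_of_le_right hind (hV j).comap_le
  have hI2 := hI.comp (hφ j) measurable_id
  have := hI2.integral_fun_mul_eq_mul_integral (hφξ j).aestronglyMeasurable (hVi j).1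
  simp only [Function.comp, id] at this
  rw [this]
  congr 1
  rw [← hunif j]
  have e : (fun ω => φ j (ξ ω)) = Set.indicator {ω | ξ ω = j} 1 := by
    ext ω; simp [φ, Set.indicator_apply]
  rw [e]
  exact integral_indicator_one (hξ (measurableSet_singleton j))

end Integrability

/-! ### Square integrability of the iterates. -/

/-- The distance of a regularized minimizer to a feasible point, independent of the positive
semidefinite part `M` of the regularization centred at that point. -/
theorem norm_sub_le_of_isMinOn {q : ℕ} {X : Set (Vec q)} (hX : Convex ℝ X)
    {H M : Matrix (Fin q) (Fin q) ℝ} (hH : H.PosDef) (hM : M.PosSemidef) {a κ : ℝ} (ha : 0 < a)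
    (hκ : ∀ v, κ * ‖v‖ ^ 2 ≤ sqNormW H v) (hκ0 : 0 < κ)
    {c u w z : Vec q} (hz : z ∈ X) (hw : w ∈ X)
    (hmin : IsMinOn (fun x => inner ℝ c x + a / 2 * sqNormW H (x - u)
      + 1 / 2 * sqNormW M (x - w)) X z) :
    ‖z - w‖ ≤ 1 / (a * κ) * (‖c‖ + a * ‖act H (w - u)‖) := by
  -- Tested at the centre w, the M-term becomes -‖w - z‖_M² and can be dropped, whatever the size of
  -- M.
  have h := variational_ineq_of_isMinOn hX hH.isHermitian hM.isHermitian hz hmin hw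
  have e1 : inner ℝ (w - z) (act M (z - w)) = -sqNormW M (w - z) := by
    rw [sqNormW, ← inner_neg_right, ← act_neg, neg_sub]
  have e2 : inner ℝ (w - z) (act H (z - u)) = inner ℝ (w - z) (act H (w - u))
      - sqNormW H (w - z) := by
    rw [sqNormW, ← inner_sub_right, ← act_sub]
    congr 2; abel
  have hMn := sqNormW_nonneg hM (w - z)
  have h1 : inner ℝ c (w - z) ≤ ‖c‖ * ‖w - z‖ := real_inner_le_norm _ _
  have h2 : inner ℝ (w - z) (act H (w - u)) ≤ ‖w - z‖ * ‖act H (w - u)‖ := real_inner_le_norm _ _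
  have h3 := hκ (w - z)
  rw [e1, e2] at h
  rw [norm_sub_rev]
  set s := ‖w - z‖
  have hs : 0 ≤ s := norm_nonneg _
  have h4 : a * κ * s ^ 2 ≤ s * (‖c‖ + a * ‖act H (w - u)‖) := by
    have := mul_le_mul_of_nonneg_left h3 ha.le
    have := mul_le_mul_of_nonneg_left h2 ha.le
    linarith
  rw [one_div, inv_mul_eq_div, le_div_iff₀ (by positivity)]
  rcases hs.eq_or_lt with h0 | h0
  · rw [← h0]
    have := norm_nonneg c
    have := norm_nonneg (act H (w - u))
    rw [zero_mul]; positivity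
  · nlinarith

namespace Problem

variable {n n₁ n₂ N : ℕ} {P : Problem n n₁ n₂ N}

/-- Linear growth of the gradients, by equivalence of the weighted and Euclidean norms; it carries
square integrability from the iterates to the gradients. -/
theorem GradLipschitz.exists_norm_le {H : Matrix (Fin n₁) (Fin n₁) ℝ} (hH : H.PosDef) {ν : ℝ}
    (hLip : P.GradLipschitz H ν) : ∃ C : ℝ, 0 ≤ C ∧ ∀ j, ∀ x ∈ P.X, ∀ z ∈ P.X,
      ‖gradient (P.fj j) x‖ ≤ ‖gradient (P.fj j) z‖ + C * ‖x - z‖ := by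
  obtain ⟨c, hc, h1⟩ := exists_le_sqNormW_inv hH
  obtain ⟨K, hK, h2⟩ := exists_sqNormW_le H
  refine ⟨√(ν ^ 2 * K / c), Real.sqrt_nonneg _, fun j x hx z hz => ?_⟩
  have hL := hLip j x hx z hz
  have hsq : sqNormW H⁻¹ (gradient (P.fj j) x - gradient (P.fj j) z)
      ≤ ν ^ 2 * sqNormW H (x - z) := by
    rw [← normW_sq hH.inv.posSemidef, ← normW_sq hH.posSemidef, ← mul_pow]
    exact pow_le_pow_left₀ (Real.sqrt_nonneg _) hL 2
  have h3 : ‖gradient (P.fj j) x - gradient (P.fj j) z‖ ^ 2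
      ≤ ν ^ 2 * K / c * ‖x - z‖ ^ 2 := by
    have := h1 (gradient (P.fj j) x - gradient (P.fj j) z)
    have h4 := mul_le_mul_of_nonneg_left (h2 (x - z)) (sq_nonneg ν)
    rw [div_mul_eq_mul_div, le_div_iff₀ hc]
    linarith
  have h5 : ‖gradient (P.fj j) x - gradient (P.fj j) z‖ ≤ √(ν ^ 2 * K / c) * ‖x - z‖ := by
    rw [← Real.sqrt_sq (norm_nonneg (x - z)), ← Real.sqrt_mul (by positivity)]
    exact Real.le_sqrt_of_sq_le h3
  have := norm_le_norm_add_norm_sub' (gradient (P.fj j) x) (gradient (P.fj j) z)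
  linarith

end Problem

namespace Trajectory

variable {n n₁ n₂ N : ℕ} {Ω : Type*} {Z : Trajectory n n₁ n₂ N Ω} {P : Problem n n₁ n₂ N}
  {S : Params n₁ n₂} {ω : Ω}

/-- Adding the `y`-optimality condition tested at y* to the saddle inequality at (x*, y^{k+1})
eliminates g. Only By and the L-seminorm of y are controlled; y itself need not be square
integrable. -/
theorem Updates.y_bound (hP : P.Standing) (hβ : 0 < S.β) (hL : S.L.PosSemidef)
    (hU : Z.Updates P S ω) {xs : Vec n₁} {ys : Vec n₂} {ls : Vec n}
    (hw : P.IsSaddlePoint xs ys ls) (k : ℕ) :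
    S.β * ‖act P.B (Z.y (k + 1) ω - ys)‖ ^ 2 + sqNormW S.L (Z.y (k + 1) ω - ys)
      ≤ 1 / S.β * ‖Z.lamHalf k ω - ls - S.β • act P.A (Z.x (k + 1) ω - xs)‖ ^ 2
        + sqNormW S.L (Z.y k ω - ys) := by
  have ho := hU.y_opt hP hL k
  have h1 := ho.2 ys (hw.mem_dom hP)
  have h2 := hw.add_le hP hw.mem_X ho.1
  have hr := hw.resid_eq_zero hP
  have e1 : P.resid xs (Z.y (k + 1) ω) = act P.B (Z.y (k + 1) ω - ys) := by
    rw [Problem.resid_eq xs xs _ ys, hr, sub_self, ← sub_self xs, act_sub]; abel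
  have e2 : P.resid (Z.x (k + 1) ω) (Z.y (k + 1) ω)
      = act P.A (Z.x (k + 1) ω - xs) + act P.B (Z.y (k + 1) ω - ys) := by
    rw [Problem.resid_eq _ xs _ ys, hr, zero_add]
  have e3 : inner ℝ (Z.y (k + 1) ω - ys) (act S.L (Z.y (k + 1) ω - Z.y k ω))
      = sqNormW S.L (Z.y (k + 1) ω - ys)
        - inner ℝ (Z.y (k + 1) ω - ys) (act S.L (Z.y k ω - ys)) := by
    rw [sqNormW, ← inner_sub_right, ← act_sub]; congr 2; abel
  have h3 := two_mul_inner_act_le hL (Z.y (k + 1) ω - ys) (Z.y k ω - ys)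
  rw [e1] at h2
  rw [e2, e3] at h1
  set u := act P.B (Z.y (k + 1) ω - ys)
  set c := Z.lamHalf k ω - ls - S.β • act P.A (Z.x (k + 1) ω - xs) with hc
  have e4 : inner ℝ (-Z.lamHalf k ω + S.β • (act P.A (Z.x (k + 1) ω - xs) + u)) u
      = -inner ℝ c u - inner ℝ ls u + S.β * ‖u‖ ^ 2 := by
    rw [hc, ← real_inner_self_eq_norm_sq]
    simp only [inner_add_left, inner_sub_left, inner_neg_left, real_inner_smul_left]
    ring
  have h5 : 2 * inner ℝ c u ≤ 1 / S.β * ‖c‖ ^ 2 + S.β * ‖u‖ ^ 2 := by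
    have h6 : 0 ≤ ‖c - S.β • u‖ ^ 2 := sq_nonneg _
    rw [norm_sub_sq_real, norm_smul, mul_pow, real_inner_smul_right, Real.norm_eq_abs, sq_abs] at h6
    have h7 := mul_nonneg (by positivity : 0 ≤ 1 / S.β) h6
    have e : 1 / S.β * (‖c‖ ^ 2 - 2 * (S.β * inner ℝ c u) + S.β ^ 2 * ‖u‖ ^ 2)
        = 1 / S.β * ‖c‖ ^ 2 - 2 * inner ℝ c u + S.β * ‖u‖ ^ 2 := by field_simp
    linarith
  rw [e4] at h1
  linarith

end Trajectory

namespace Problem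

variable {n n₁ n₂ N : ℕ} {P : Problem n n₁ n₂ N} {Ω : Type*} [MeasurableSpace Ω] {μ : Measure Ω}

theorem GradLipschitz.memLp_gradient_fj [IsFiniteMeasure μ] {H : Matrix (Fin n₁) (Fin n₁) ℝ}
    (hH : H.PosDef) {ν : ℝ} (hLip : P.GradLipschitz H ν) {X : Ω → Vec n₁} (hX : MemLp X 2 μ)
    (hXm : ∀ ω, X ω ∈ P.X) {z : Vec n₁} (hz : z ∈ P.X) (j : Fin N) :
    MemLp (fun ω => gradient (P.fj j) (X ω)) 2 μ := by
  obtain ⟨C, -, h⟩ := hLip.exists_norm_le hH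
  have hXz : MemLp (fun ω => ‖X ω - z‖) 2 μ := (hX.sub (memLp_const z)).norm
  have hg : MemLp (fun ω => ‖gradient (P.fj j) z‖ + C * ‖X ω - z‖) 2 μ :=
    (memLp_const ‖gradient (P.fj j) z‖).add (hXz.const_mul C)
  exact hg.mono' ((measurable_gradient _).comp_aemeasurable hX.1.aemeasurable).aestronglyMeasurable
    (Eventually.of_forall fun ω => h j _ (hXm ω) z hz)

theorem GradLipschitz.memLp_gradient_f [IsFiniteMeasure μ] (hP : P.Standing)
    {H : Matrix (Fin n₁) (Fin n₁) ℝ}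
    (hH : H.PosDef) {ν : ℝ} (hLip : P.GradLipschitz H ν) {X : Ω → Vec n₁} (hX : MemLp X 2 μ)
    (hXm : ∀ ω, X ω ∈ P.X) {z : Vec n₁} (hz : z ∈ P.X) :
    MemLp (fun ω => gradient P.f (X ω)) 2 μ := by
  have h : (fun ω => gradient P.f (X ω))
      = fun ω => (1 / (N : ℝ)) • ∑ j, gradient (P.fj j) (X ω) :=
    funext fun ω => hP.gradient_f (hXm ω)
  rw [h]
  exact (memLp_finsetSum _ fun j _ => hLip.memLp_gradient_fj hH hX hXm hz j).const_smul
    (1 / (N : ℝ))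

end Problem

namespace Trajectory

variable {n n₁ n₂ N : ℕ} {Ω : Type*} [MeasurableSpace Ω] {Z : Trajectory n n₁ n₂ N Ω}
  {P : Problem n n₁ n₂ N} {S : Params n₁ n₂} {μ : Measure Ω}
  {𝓖 : Filtration (ℕ ×ₗ ℕ) (inferInstance : MeasurableSpace Ω)}

theorem IsRun.x_zero_mem (hR : Z.IsRun P S μ 𝓖) (ω : Ω) : Z.x 0 ω ∈ P.X := by
  obtain ⟨x₀, h0, h⟩ := hR.x_zero
  rw [h]; exact h0

theorem IsRun.x_meas (hR : Z.IsRun P S μ 𝓖) (k : ℕ) : StronglyMeasurable (Z.x k) :=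
  (hR.sampling.x_meas k).mono (𝓖.le _)

theorem IsRun.xb_meas (hR : Z.IsRun P S μ 𝓖) (k : ℕ) : StronglyMeasurable (Z.xb k) :=
  (hR.sampling.xb_meas k).mono (𝓖.le _)

theorem IsRun.y_meas (hR : Z.IsRun P S μ 𝓖) (k : ℕ) : StronglyMeasurable (Z.y k) :=
  (hR.sampling.y_meas k).mono (𝓖.le _)

/-- The last inner index m_k + 1 is not covered by `Sampling`; there the iterate is x̆^{k+1}. -/
theorem IsRun.xbin_meas (hR : Z.IsRun P S μ 𝓖) {k t : ℕ} (ht : t ≤ S.m k) :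
    StronglyMeasurable (Z.xbin k (t + 1)) := by
  rcases ht.eq_or_lt with rfl | h
  · have : Z.xbin k (S.m k + 1) = Z.xb (k + 1) := funext fun ω => ((hR.updates ω).xb_succ k).symm
    rw [this]; exact hR.xb_meas _
  · exact (hR.sampling.xbin_meas k (t + 1) (Finset.mem_Icc.2 ⟨by omega, h⟩)).mono (𝓖.le _)

theorem Sampling.xhat_meas (hS : Z.Sampling S μ 𝓖) {k t : ℕ} (ht : t ∈ Finset.Icc 1 (S.m k)) :
    StronglyMeasurable[𝓖 (toLex (k, t - 1))] (Z.xhat k t) :=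
  ((hS.xbin_meas k t ht).const_smul (2 / ((t : ℝ) + 1))).add
    ((hS.xin_meas k t ht).const_smul (1 - 2 / ((t : ℝ) + 1)))

theorem Sampling.ξ_measurable (hS : Z.Sampling S μ 𝓖) {k t : ℕ}
    (ht : t ∈ Finset.Icc 1 (S.m k)) : Measurable (Z.ξ k t) :=
  (hS.ξ_meas k t ht).mono (𝓖.le _) le_rfl

theorem Sampling.gradient_ξ_meas (hS : Z.Sampling S μ 𝓖) (P : Problem n n₁ n₂ N) {k t : ℕ}
    (ht : t ∈ Finset.Icc 1 (S.m k)) :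
    Measurable (fun ω => gradient (P.fj (Z.ξ k t ω)) (Z.xhat k t ω)) := by
  have h : Measurable (fun p : Fin N × Vec n₁ => gradient (P.fj p.1) p.2) :=
    measurable_from_prod_countable_right fun j => measurable_gradient (P.fj j)
  exact h.comp ((hS.ξ_measurable ht).prodMk ((hS.xhat_meas ht).mono (𝓖.le _)).measurable)

theorem Sampling.δ_meas (hS : Z.Sampling S μ 𝓖) (P : Problem n n₁ n₂ N) {k t : ℕ}
    (ht : t ∈ Finset.Icc 1 (S.m k)) : Measurable (Z.δ P k t) :=
  ((measurable_gradient P.f).comp ((hS.xhat_meas ht).mono (𝓖.le _)).measurable).sub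
    ((hS.gradient_ξ_meas P ht).add ((hS.e_meas k t ht).mono (𝓖.le _)).measurable)

theorem Sampling.memLp_δ (hS : Z.Sampling S μ 𝓖) (hH : S.H.PosDef) {k t : ℕ}
    (ht : t ∈ Finset.Icc 1 (S.m k))
    (hδ : Integrable (fun ω => sqNormW S.H⁻¹ (Z.δ P k t ω)) μ) : MemLp (Z.δ P k t) 2 μ := by
  obtain ⟨c, hc, h⟩ := exists_le_sqNormW_inv hH
  refine memLp_of_norm_sq_le (hS.δ_meas P ht).aestronglyMeasurable (hδ.const_mul (1 / c))
    fun ω => ?_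
  rw [one_div, inv_mul_eq_div, le_div_iff₀ hc, mul_comm]
  exact h _

/-- Square integrability of the outer iterates. -/
structure SqIntegrable (Z : Trajectory n n₁ n₂ N Ω) (P : Problem n n₁ n₂ N) (S : Params n₁ n₂)
    (μ : Measure Ω) (ys : Vec n₂) (k : ℕ) : Prop where
  x : MemLp (Z.x k) 2 μ
  xb : MemLp (Z.xb k) 2 μ
  lam : MemLp (Z.lam k) 2 μ
  By : MemLp (fun ω => act P.B (Z.y k ω - ys)) 2 μ
  Ly : Integrable (fun ω => sqNormW S.L (Z.y k ω - ys)) μ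

theorem memLp_xhat {k t : ℕ} (h1 : MemLp (Z.xin k t) 2 μ) (h2 : MemLp (Z.xbin k t) 2 μ) :
    MemLp (Z.xhat k t) 2 μ :=
  (h2.const_smul (2 / ((t : ℝ) + 1))).add (h1.const_smul (1 - 2 / ((t : ℝ) + 1)))

variable [IsFiniteMeasure μ]

theorem SqIntegrable.resid {ys : Vec n₂} {k : ℕ} (hk : Z.SqIntegrable P S μ ys k)
    {xs : Vec n₁} (hr : P.resid xs ys = 0) {X : Ω → Vec n₁} (hX : MemLp X 2 μ) :
    MemLp (fun ω => P.resid (X ω) (Z.y k ω)) 2 μ := by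
  have h : (fun ω => P.resid (X ω) (Z.y k ω))
      = fun ω => act P.A (X ω - xs) + act P.B (Z.y k ω - ys) := funext fun ω => by
    rw [Problem.resid_eq _ xs _ ys, hr, zero_add]
  rw [h]
  exact (memLp_act P.A (hX.sub (memLp_const xs))).add hk.By

/-- M_k may be random and unbounded. As its proximal term is centred at xᵏ ∈ X,
`norm_sub_le_of_isMinOn` bounds x̆_{t+1} - xᵏ by square integrable quantities free of M_k. -/
theorem IsRun.memLp_inner (hR : Z.IsRun P S μ 𝓖) (hP : P.Standing) (hβ : 0 < S.β)
    (hH : S.H.PosDef) {ν : ℝ} (hLip : P.GradLipschitz S.H ν) (hη0 : ∀ k, 0 < S.η k)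
    (hδ : ∀ k, ∀ t ∈ Finset.Icc 1 (S.m k),
      Integrable (fun ω => sqNormW S.H⁻¹ (Z.δ P k t ω)) μ)
    {xs : Vec n₁} {ys : Vec n₂} {ls : Vec n} (hw : P.IsSaddlePoint xs ys ls) {k : ℕ}
    (hk : Z.SqIntegrable P S μ ys k) {t : ℕ} (ht : t ≤ S.m k) :
    MemLp (Z.xin k (t + 1)) 2 μ ∧ MemLp (Z.xbin k (t + 1)) 2 μ := by
  induction t with
  | zero =>
    have h1 : Z.xin k (0 + 1) = Z.x k := funext fun ω => (hR.updates ω).xin_one k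
    have h2 : Z.xbin k (0 + 1) = Z.xb k := funext fun ω => (hR.updates ω).xbin_one k
    rw [h1, h2]
    exact ⟨hk.x, hk.xb⟩
  | succ t ih =>
    obtain ⟨i1, i2⟩ := ih (by omega)
    have hmem : t + 1 ∈ Finset.Icc 1 (S.m k) := Finset.mem_Icc.2 ⟨by omega, ht⟩
    have hhatm : ∀ ω, Z.xhat k (t + 1) ω ∈ P.X := fun ω =>
      (hR.updates ω).xhat_mem hP (hR.x_zero_mem ω) hmem
    have hgrad := hLip.memLp_gradient_f hP hH (memLp_xhat i1 i2) hhatm hw.mem_X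
    have hd : MemLp (Z.d P k (t + 1)) 2 μ := by
      have : Z.d P k (t + 1) = (fun ω => gradient P.f (Z.xhat k (t + 1) ω)) - Z.δ P k (t + 1) := by
        ext1 ω; simp [δ]
      rw [this]
      exact hgrad.sub (hR.sampling.memLp_δ hH hmem (hδ k _ hmem))
    have hh : MemLp (Z.h P S k) 2 μ :=
      (memLp_act P.Aᵀ (hk.lam.sub ((hk.resid (hw.resid_eq_zero hP) hk.x).const_smul S.β))).neg
    obtain ⟨c, hc, hcH⟩ := exists_le_sqNormW hH
    set a : ℝ := 2 / (((t + 1 : ℕ) : ℝ) * S.η k) with ha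
    have ha0 : 0 < a := by have := hη0 k; positivity
    have hxb : MemLp (Z.xbin k (t + 1 + 1)) 2 μ := by
      have hdiff : MemLp (fun ω => Z.xbin k (t + 1 + 1) ω - Z.x k ω) 2 μ := by
        refine MemLp.mono' (g := fun ω => 1 / (a * c) * (‖Z.d P k (t + 1) ω + Z.h P S k ω‖
          + a * ‖act S.H (Z.x k ω - Z.xbin k (t + 1) ω)‖)) ?_
          ((hR.xbin_meas ht).sub (hR.x_meas k)).aestronglyMeasurable
          (Eventually.of_forall fun ω => ?_)
        · exact ((hd.add hh).norm.add ((memLp_act S.H (hk.x.sub i2)).norm.const_mul a)).const_mul _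
        · have hs := (hR.updates ω).xbin_succ k (t + 1) hmem
          exact norm_sub_le_of_isMinOn hP.convex_X hH ((hR.updates ω).M_psd hβ k) ha0 hcH hc hs.1
            ((hR.updates ω).mem_X hP (hR.x_zero_mem ω) k).1 hs.2
      have e : Z.xbin k (t + 1 + 1)
          = Z.x k + fun ω => Z.xbin k (t + 1 + 1) ω - Z.x k ω := by ext1 ω; simp
      rw [e]
      exact hk.x.add hdiff
    refine ⟨?_, hxb⟩
    have e : Z.xin k (t + 1 + 1) = (2 / (((t + 1 : ℕ) : ℝ) + 1)) • Z.xbin k (t + 1 + 1)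
        + (1 - 2 / (((t + 1 : ℕ) : ℝ) + 1)) • Z.xin k (t + 1) :=
      funext fun ω => (hR.updates ω).xin_succ k (t + 1) hmem
    rw [e]
    exact (hxb.const_smul _).add (i1.const_smul _)

/-- Induction along the algorithm: inner loop, half-step multiplier, `y`-step through `y_bound`,
full multiplier. The residual needs only x and B(y - y*), because the saddle point is feasible. -/
theorem IsRun.sqIntegrable (hR : Z.IsRun P S μ 𝓖) (hP : P.Standing) (hβ : 0 < S.β)
    (hH : S.H.PosDef) (hL : S.L.PosSemidef) {ν : ℝ} (hLip : P.GradLipschitz S.H ν)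
    (hη0 : ∀ k, 0 < S.η k)
    (hδ : ∀ k, ∀ t ∈ Finset.Icc 1 (S.m k),
      Integrable (fun ω => sqNormW S.H⁻¹ (Z.δ P k t ω)) μ)
    {xs : Vec n₁} {ys : Vec n₂} {ls : Vec n} (hw : P.IsSaddlePoint xs ys ls) (k : ℕ) :
    Z.SqIntegrable P S μ ys k := by
  induction k with
  | zero =>
    obtain ⟨x₀, -, hx⟩ := hR.x_zero
    obtain ⟨y₀, -, hy⟩ := hR.y_zero
    obtain ⟨l₀, hl⟩ := hR.lam_zero
    have ex : Z.x 0 = fun _ => x₀ := funext hx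
    have exb : Z.xb 0 = fun _ => x₀ := funext fun ω => by rw [(hR.updates ω).xb_zero, hx]
    have el : Z.lam 0 = fun _ => l₀ := funext hl
    refine ⟨ex ▸ memLp_const _, exb ▸ memLp_const _, el ▸ memLp_const _, ?_, ?_⟩
    · simp only [hy]; exact memLp_const _
    · simp only [hy]; exact integrable_const _
  | succ k hk =>
    have hr := hw.resid_eq_zero hP
    obtain ⟨h1, h2⟩ := hR.memLp_inner hP hβ hH hLip hη0 hδ hw hk le_rfl
    have ex : Z.xin k (S.m k + 1) = Z.x (k + 1) := funext fun ω => ((hR.updates ω).x_succ k).symm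
    have exb : Z.xbin k (S.m k + 1) = Z.xb (k + 1) :=
      funext fun ω => ((hR.updates ω).xb_succ k).symm
    rw [ex] at h1
    rw [exb] at h2
    have hhalf : MemLp (Z.lamHalf k) 2 μ := by
      have e : Z.lamHalf k = Z.lam k
          - (S.τ * S.β) • fun ω => P.resid (Z.x (k + 1) ω) (Z.y k ω) :=
        funext fun ω => (hR.updates ω).lamHalf_eq k
      rw [e]
      exact hk.lam.sub ((hk.resid hr h1).const_smul _)
    have hbound : Integrable (fun ω => 1 / S.β * ‖Z.lamHalf k ω - ls
        - S.β • act P.A (Z.x (k + 1) ω - xs)‖ ^ 2 + sqNormW S.L (Z.y k ω - ys)) μ :=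
      ((integrable_norm_sq_of_memLp ((hhalf.sub (memLp_const ls)).sub
        ((memLp_act P.A (h1.sub (memLp_const xs))).const_smul S.β))).const_mul _).add hk.Ly
    have hym : StronglyMeasurable (fun ω => Z.y (k + 1) ω - ys) :=
      (hR.y_meas (k + 1)).sub stronglyMeasurable_const
    have hBy : MemLp (fun ω => act P.B (Z.y (k + 1) ω - ys)) 2 μ := by
      refine memLp_of_norm_sq_le
        ((continuous_act P.B).comp_stronglyMeasurable hym).aestronglyMeasurable
        (hbound.const_mul (1 / S.β)) fun ω => ?_
      have h3 := (hR.updates ω).y_bound hP hβ hL hw k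
      have h4 := sqNormW_nonneg hL (Z.y (k + 1) ω - ys)
      rw [one_div S.β, inv_mul_eq_div, le_div_iff₀ hβ]
      rw [← one_div]
      linarith
    have hLy : Integrable (fun ω => sqNormW S.L (Z.y (k + 1) ω - ys)) μ := by
      refine hbound.mono'
        ((continuous_sqNormW S.L).comp_stronglyMeasurable hym).aestronglyMeasurable
        (Eventually.of_forall fun ω => ?_)
      have h3 := (hR.updates ω).y_bound hP hβ hL hw k
      have h4 := sqNormW_nonneg hL (Z.y (k + 1) ω - ys)
      have h5 : 0 ≤ S.β * ‖act P.B (Z.y (k + 1) ω - ys)‖ ^ 2 := by positivity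
      rw [Real.norm_of_nonneg h4]
      linarith
    refine ⟨h1, h2, ?_, hBy, hLy⟩
    have e : Z.lam (k + 1) = Z.lamHalf k - (S.s * S.β) • fun ω =>
        (act P.A (Z.x (k + 1) ω - xs) + act P.B (Z.y (k + 1) ω - ys)) :=
      funext fun ω => by
        rw [(hR.updates ω).lam_succ k, Problem.resid_eq _ xs _ ys, hr, zero_add]; rfl
    rw [e]
    exact hhalf.sub (((memLp_act P.A (h1.sub (memLp_const xs))).add hBy).const_smul _)

/-- The gradient errors are uncorrelated with the current iterate. -/
theorem IsRun.integral_inner_δ (hR : Z.IsRun P S μ 𝓖) (hP : P.Standing)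
    (hH : S.H.PosDef) {ν : ℝ} (hLip : P.GradLipschitz S.H ν) {xs : Vec n₁} (hxs : xs ∈ P.X)
    {k t : ℕ} (ht : t ∈ Finset.Icc 1 (S.m k)) (h1 : MemLp (Z.xin k t) 2 μ)
    (h2 : MemLp (Z.xbin k t) 2 μ) (hδ : MemLp (Z.δ P k t) 2 μ) :
    ∫ ω, inner ℝ (Z.δ P k t ω) (Z.xbin k t ω - xs) ∂μ = 0 := by
  have hS := hR.sampling
  have hle := 𝓖.le (toLex (k, t - 1))
  have hhatm : ∀ ω, Z.xhat k t ω ∈ P.X := fun ω =>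
    (hR.updates ω).xhat_mem hP (hR.x_zero_mem ω) ht
  have hhat := memLp_xhat h1 h2
  have hY : MemLp (fun ω => Z.xbin k t ω - xs) 2 μ := h2.sub (memLp_const xs)
  have hYm : StronglyMeasurable[𝓖 (toLex (k, t - 1))] (fun ω => Z.xbin k t ω - xs) :=
    (hS.xbin_meas k t ht).sub stronglyMeasurable_const
  have hgj := fun j => hLip.memLp_gradient_fj hH hhat hhatm hxs j
  have hg := hLip.memLp_gradient_f hP hH hhat hhatm hxs
  have hgξ : MemLp (fun ω => gradient (P.fj (Z.ξ k t ω)) (Z.xhat k t ω)) 2 μ := by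
    refine MemLp.mono' (memLp_finsetSum Finset.univ fun j _ => (hgj j).norm)
      (hS.gradient_ξ_meas P ht).aestronglyMeasurable (Eventually.of_forall fun ω => ?_)
    exact Finset.single_le_sum (f := fun j => ‖gradient (P.fj j) (Z.xhat k t ω)‖)
      (fun _ _ => norm_nonneg _) (Finset.mem_univ _)
  -- The noise e is assumed only integrable; its square integrability follows from that of δ and of
  -- the gradients, and makes ⟨e, x̆ - x*⟩ integrable.
  have he : MemLp (Z.e k t) 2 μ := by
    have e : Z.e k t = (fun ω => gradient P.f (Z.xhat k t ω))
        - (fun ω => gradient (P.fj (Z.ξ k t ω)) (Z.xhat k t ω)) - Z.δ P k t := by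
      ext1 ω; simp [δ, d]
    rw [e]
    exact (hg.sub hgξ).sub hδ
  have heY := integrable_inner_of_memLp he hY
  have e0 := integral_inner_eq_zero_of_condExp hle (hS.e_int k t ht) (hS.e_mean k t ht) hYm heY
  have hV := fun j => integrable_inner_of_memLp (hgj j) hY
  have e1 := integral_uniform_index (m := 𝓖 (toLex (k, t - 1))) (hS.ξ_measurable ht)
    (hS.ξ_unif k t ht) (hS.ξ_indep k t ht)
    (V := fun j ω => inner ℝ (gradient (P.fj j) (Z.xhat k t ω)) (Z.xbin k t ω - xs))
    (fun j => (StronglyMeasurable.inner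
      (((measurable_gradient (P.fj j)).comp (hS.xhat_meas ht).measurable).stronglyMeasurable)
      hYm).measurable) hV
  have e2 : ∫ ω, inner ℝ (gradient P.f (Z.xhat k t ω)) (Z.xbin k t ω - xs) ∂μ
      = 1 / (N : ℝ)
        * ∑ j, ∫ ω, inner ℝ (gradient (P.fj j) (Z.xhat k t ω)) (Z.xbin k t ω - xs) ∂μ := by
    rw [← integral_finsetSum _ fun j _ => hV j, ← integral_const_mul]
    refine integral_congr_ae (Eventually.of_forall fun ω => ?_)
    simp only [hP.gradient_f (hhatm ω), real_inner_smul_left, sum_inner]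
  have e3 : ∀ ω, inner ℝ (Z.δ P k t ω) (Z.xbin k t ω - xs)
      = inner ℝ (gradient P.f (Z.xhat k t ω)) (Z.xbin k t ω - xs)
        - inner ℝ (gradient (P.fj (Z.ξ k t ω)) (Z.xhat k t ω)) (Z.xbin k t ω - xs)
        - inner ℝ (Z.e k t ω) (Z.xbin k t ω - xs) := fun ω => by
    rw [δ, d, inner_sub_left, inner_add_left]; ring
  have i1 := integrable_inner_of_memLp hg hY
  have i2 := integrable_inner_of_memLp hgξ hY
  simp_rw [e3]
  rw [integral_sub (by exact i1.sub i2) heY, integral_sub i1 i2, e0, e1, e2]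
  ring

end Trajectory

/-! ### Asymptotics and the choice of m_k and η_k. -/

section Rates

theorem isBigO_one_div_of_le {q : ℕ → ℝ} {K : ℝ} (hq : ∀ T, |q T| ≤ 1 / ((T : ℝ) + 1) * K) :
    q =O[atTop] (fun T : ℕ => 1 / (T : ℝ)) := by
  have hK : 0 ≤ K := by simpa using (abs_nonneg _).trans (hq 0)
  refine IsBigO.of_bound K ?_
  filter_upwards [eventually_ge_atTop 1] with T hT
  have hT' : (0 : ℝ) < T := by exact_mod_cast hT
  rw [Real.norm_eq_abs, Real.norm_of_nonneg (by positivity)]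
  refine (hq T).trans ?_
  rw [mul_comm]
  gcongr
  linarith

theorem isBigO_log_div_of_le {q : ℕ → ℝ} {K₁ K₂ : ℝ} (hK₁ : 0 ≤ K₁) (hK₂ : 0 ≤ K₂)
    (hq : ∀ T : ℕ, 1 ≤ T → |q T| ≤ 1 / ((T : ℝ) + 1) * (K₁ + K₂ * Real.log T)) :
    q =O[atTop] (fun T : ℕ => Real.log (T : ℝ) / (T : ℝ)) := by
  refine IsBigO.of_bound (K₁ / Real.log 2 + K₂) ?_
  -- From T = 2 on, log T ≥ log 2 > 0, so the constant K₁ can be absorbed into (K₁/log 2) log T.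
  filter_upwards [eventually_ge_atTop 2] with T hT
  have hT' : (2 : ℝ) ≤ T := by exact_mod_cast hT
  have hT0 : (0 : ℝ) < T := by linarith
  have hl2 : 0 < Real.log 2 := Real.log_pos (by norm_num)
  have hl : Real.log 2 ≤ Real.log T := Real.log_le_log (by norm_num) hT'
  have hl0 : 0 ≤ Real.log T := hl2.le.trans hl
  rw [Real.norm_eq_abs, Real.norm_of_nonneg (by positivity)]
  refine (hq T (by omega)).trans ?_
  have h1 : K₁ ≤ K₁ / Real.log 2 * Real.log T := by
    rw [div_mul_eq_mul_div, le_div_iff₀ hl2]; gcongr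
  calc 1 / ((T : ℝ) + 1) * (K₁ + K₂ * Real.log T)
      ≤ 1 / (T : ℝ) * (K₁ / Real.log 2 * Real.log T + K₂ * Real.log T) := by
        gcongr; linarith
    _ = _ := by ring

theorem sum_one_div_le_log {κ T : ℕ} (hκ : 0 < κ) (hT : 1 ≤ T) :
    ∑ k ∈ Finset.Icc κ (κ + T), 1 / (k : ℝ) ≤ 1 + Real.log (κ + 1) + Real.log T := by
  have h1 : ∑ k ∈ Finset.Icc κ (κ + T), 1 / (k : ℝ) ≤ ∑ k ∈ Finset.Icc 1 (κ + T), 1 / (k : ℝ) :=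
    Finset.sum_le_sum_of_subset_of_nonneg (Finset.Icc_subset_Icc_left hκ)
      fun _ _ _ => by positivity
  have h2 := harmonic_le_one_add_log (κ + T)
  rw [harmonic_eq_sum_Icc] at h2
  push_cast at h2
  have hT' : (1 : ℝ) ≤ T := by exact_mod_cast hT
  -- This rests on κ + T ≤ (κ + 1)T for T ≥ 1.
  have h3 : Real.log ((κ : ℝ) + T) ≤ Real.log (κ + 1) + Real.log T := by
    rw [← Real.log_mul (by positivity) (by positivity)]
    refine Real.log_le_log (by positivity) ?_
    have : (0 : ℝ) ≤ κ := by positivity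
    nlinarith
  simp only [one_div] at h1 ⊢
  linarith

end Rates

namespace Params

variable {n₁ n₂ : ℕ} {S : Params n₁ n₂} {c₁ c₂ c₃ ϱ : ℝ} {m : ℕ}

theorem m_mono (hc₃ : 0 < c₃) (hϱ : 1 ≤ ϱ)
    (hmk : ∀ k : ℕ, S.m k = max ⌈c₃ * (k : ℝ) ^ ϱ⌉₊ m) : Monotone S.m := by
  intro j k hjk
  rw [hmk, hmk]
  refine max_le_max (Nat.ceil_mono ?_) le_rfl
  gcongr

theorem one_div_m_le (hc₃ : 0 < c₃)
    (hmk : ∀ k : ℕ, S.m k = max ⌈c₃ * (k : ℝ) ^ ϱ⌉₊ m) {k : ℕ} (hk : 0 < k) :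
    1 / (S.m k : ℝ) ≤ 1 / c₃ * (1 / (k : ℝ) ^ ϱ) := by
  have hk' : (0 : ℝ) < k := by exact_mod_cast hk
  have h : c₃ * (k : ℝ) ^ ϱ ≤ S.m k := by
    rw [hmk]
    exact (Nat.le_ceil _).trans (by exact_mod_cast le_max_left _ _)
  have h0 : 0 < (k : ℝ) ^ ϱ := Real.rpow_pos_of_pos hk' _
  calc 1 / (S.m k : ℝ) ≤ 1 / (c₃ * (k : ℝ) ^ ϱ) := by gcongr
    _ = _ := by field_simp

/-- The minimum in η_k makes m_k(m_k+1)η_k equal to min(c₁, c₂m_k(m_k+1)), which is monotone because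
m_k is. -/
theorem weight_antitone (hc₁ : 0 < c₁) (hc₂ : 0 < c₂) (hm : ∀ k, 0 < S.m k) (hmono : Monotone S.m)
    (hηk : ∀ k : ℕ, S.η k = min (c₁ / ((S.m k : ℝ) * ((S.m k : ℝ) + 1))) c₂) :
    Antitone S.weight := by
  have e : ∀ k, S.weight k = 2 / min c₁ ((S.m k : ℝ) * ((S.m k : ℝ) + 1) * c₂) := fun k => by
    have : (0 : ℝ) < S.m k := by exact_mod_cast hm k
    rw [weight, hηk, mul_min_of_nonneg _ _ (by positivity), mul_div_cancel₀ _ (by positivity)]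
  intro j k hjk
  rw [e, e]
  have h1 : (S.m j : ℝ) ≤ S.m k := by exact_mod_cast hmono hjk
  have h0 : (0 : ℝ) < S.m j := by exact_mod_cast hm j
  gcongr

end Params

/-! ### Expectation of the noise, the initial potential and measurability. -/

namespace Trajectory

variable {n n₁ n₂ N : ℕ} {Ω : Type*} [MeasurableSpace Ω] {Z : Trajectory n n₁ n₂ N Ω}
  {P : Problem n n₁ n₂ N} {S : Params n₁ n₂} {μ : Measure Ω}
  {𝓖 : Filtration (ℕ ×ₗ ℕ) (inferInstance : MeasurableSpace Ω)}

section Noise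

variable [IsFiniteMeasure μ]

theorem IsRun.memLp_xin (hR : Z.IsRun P S μ 𝓖) (hP : P.Standing) (hβ : 0 < S.β)
    (hH : S.H.PosDef) (hL : S.L.PosSemidef) {ν : ℝ} (hLip : P.GradLipschitz S.H ν)
    (hη0 : ∀ k, 0 < S.η k)
    (hδ : ∀ k, ∀ t ∈ Finset.Icc 1 (S.m k),
      Integrable (fun ω => sqNormW S.H⁻¹ (Z.δ P k t ω)) μ)
    {xs : Vec n₁} {ys : Vec n₂} {ls : Vec n} (hw : P.IsSaddlePoint xs ys ls) {k t : ℕ}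
    (ht : t ∈ Finset.Icc 1 (S.m k)) : MemLp (Z.xin k t) 2 μ ∧ MemLp (Z.xbin k t) 2 μ := by
  obtain ⟨h1, h2⟩ := Finset.mem_Icc.1 ht
  obtain ⟨u, rfl⟩ : ∃ u, t = u + 1 := ⟨t - 1, by omega⟩
  exact hR.memLp_inner hP hβ hH hLip hη0 hδ hw
    (hR.sqIntegrable hP hβ hH hL hLip hη0 hδ hw k) (by omega)

theorem IsRun.noise_integral (hR : Z.IsRun P S μ 𝓖) (hP : P.Standing) (hβ : 0 < S.β)
    (hH : S.H.PosDef) (hL : S.L.PosSemidef) {ν : ℝ} (hLip : P.GradLipschitz S.H ν)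
    (hη0 : ∀ k, 0 < S.η k)
    (hδ : ∀ k, ∀ t ∈ Finset.Icc 1 (S.m k),
      Integrable (fun ω => sqNormW S.H⁻¹ (Z.δ P k t ω)) μ)
    {xs : Vec n₁} {ys : Vec n₂} {ls : Vec n} (hw : P.IsSaddlePoint xs ys ls) (k : ℕ) :
    Integrable (Z.noise P S xs k) μ ∧
    ∫ ω, Z.noise P S xs k ω ∂μ = 2 / ((S.m k : ℝ) * (S.m k + 1)) * ∑ t ∈ Finset.Icc 1 (S.m k),
      S.η k / 2 * ((t : ℝ) ^ 2 * ∫ ω, sqNormW S.H⁻¹ (Z.δ P k t ω) ∂μ) := by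
  have hx := fun t (ht : t ∈ Finset.Icc 1 (S.m k)) =>
    hR.memLp_xin hP hβ hH hL hLip hη0 hδ hw ht
  have hδL := fun t (ht : t ∈ Finset.Icc 1 (S.m k)) => hR.sampling.memLp_δ hH ht (hδ k t ht)
  have i1 : ∀ t ∈ Finset.Icc 1 (S.m k), Integrable
      (fun ω => (t : ℝ) * inner ℝ (Z.δ P k t ω) (Z.xbin k t ω - xs)) μ := fun t ht =>
    (integrable_inner_of_memLp (hδL t ht) ((hx t ht).2.sub (memLp_const xs))).const_mul (t : ℝ)
  have i2 : ∀ t ∈ Finset.Icc 1 (S.m k), Integrable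
      (fun ω => S.η k / 2 * ((t : ℝ) ^ 2 * sqNormW S.H⁻¹ (Z.δ P k t ω))) μ := fun t ht =>
    ((hδ k t ht).const_mul ((t : ℝ) ^ 2)).const_mul (S.η k / 2)
  have i3 : ∀ t ∈ Finset.Icc 1 (S.m k), Integrable
      (fun ω => (t : ℝ) * inner ℝ (Z.δ P k t ω) (Z.xbin k t ω - xs)
        + S.η k / 2 * ((t : ℝ) ^ 2 * sqNormW S.H⁻¹ (Z.δ P k t ω))) μ := fun t ht =>
    (i1 t ht).add (i2 t ht)
  refine ⟨(integrable_finsetSum _ i3).const_mul _, ?_⟩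
  unfold noise
  rw [integral_const_mul, integral_finsetSum _ i3]
  congr 1
  refine Finset.sum_congr rfl fun t ht => ?_
  rw [integral_add (i1 t ht) (i2 t ht), integral_const_mul, integral_const_mul, integral_const_mul,
    hR.integral_inner_δ hP hH hLip hw.mem_X ht (hx t ht).1 (hx t ht).2 (hδL t ht)]
  ring

/-- Crude bounds suffice: t ≤ M in each of the M terms, and the upper bound on η, give c₁σ²M/(M+1)²
≤ c₁σ²/M. -/
theorem sum_noise_bound {M : ℕ} (hM : 0 < M) {η c₁ σ : ℝ} (hη0 : 0 < η)
    (hη : η ≤ c₁ / ((M : ℝ) * ((M : ℝ) + 1))) {v : ℕ → ℝ}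
    (hv : ∀ t ∈ Finset.Icc 1 M, v t ≤ σ ^ 2) :
    2 / ((M : ℝ) * (M + 1)) * ∑ t ∈ Finset.Icc 1 M, η / 2 * ((t : ℝ) ^ 2 * v t)
      ≤ c₁ * σ ^ 2 * (1 / (M : ℝ)) := by
  have hM' : (0 : ℝ) < M := by exact_mod_cast hM
  have h1 : ∑ t ∈ Finset.Icc 1 M, η / 2 * ((t : ℝ) ^ 2 * v t)
      ≤ ∑ _t ∈ Finset.Icc 1 M, η / 2 * ((M : ℝ) ^ 2 * σ ^ 2) := by
    refine Finset.sum_le_sum fun t ht => ?_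
    have htM : (t : ℝ) ≤ M := by exact_mod_cast (Finset.mem_Icc.1 ht).2
    have hvt := hv t ht
    calc η / 2 * ((t : ℝ) ^ 2 * v t) ≤ η / 2 * ((t : ℝ) ^ 2 * σ ^ 2) := by gcongr
      _ ≤ _ := by gcongr
  rw [Finset.sum_const, Nat.card_Icc, Nat.add_sub_cancel, nsmul_eq_mul] at h1
  have hc₁ : 0 < c₁ := by
    by_contra! h
    have : c₁ / ((M : ℝ) * ((M : ℝ) + 1)) ≤ 0 := div_nonpos_of_nonpos_of_nonneg h (by positivity)
    linarith
  calc _ ≤ 2 / ((M : ℝ) * (M + 1)) * (M * (η / 2 * ((M : ℝ) ^ 2 * σ ^ 2))) := by gcongr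
    _ ≤ 2 / ((M : ℝ) * (M + 1)) * (M * (c₁ / ((M : ℝ) * ((M : ℝ) + 1)) / 2
        * ((M : ℝ) ^ 2 * σ ^ 2))) := by gcongr
    _ = c₁ * σ ^ 2 * ((M : ℝ) / (((M : ℝ) + 1) * ((M : ℝ) + 1))) := by field_simp
    _ ≤ c₁ * σ ^ 2 * (1 / (M : ℝ)) := by
      gcongr ?_ * ?_
      rw [div_le_div_iff₀ (by positivity) (by positivity)]
      nlinarith

end Noise

/-- The initial potential is dominated, uniformly over bounded multipliers, by an integrable
variable. -/
theorem exists_potential_le [IsFiniteMeasure μ] (hβ : 0 < S.β) (hL : S.L.PosSemidef)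
    (hΔ : (S.τ, S.s) ∈ Delta) {xs : Vec n₁} {ys : Vec n₂} (hr : P.resid xs ys = 0) {κ : ℕ}
    (hM : ∃ R : ℝ, ∀ ω, (R • (1 : Matrix (Fin n₁) (Fin n₁) ℝ) - Z.M κ ω).PosSemidef)
    (h1 : Z.SqIntegrable P S μ ys κ) (h0 : Z.SqIntegrable P S μ ys (κ - 1)) (ρ : ℝ) :
    ∃ Φ : Ω → ℝ, Integrable Φ μ ∧
      ∀ ω, ∀ l : Vec n, ‖l‖ ≤ ρ → Z.potential P S xs ys l κ ω ≤ Φ ω := by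
  obtain ⟨R, hM⟩ := hM
  obtain ⟨C, hC, hV⟩ := exists_dualForm_le (E := Vec n) S.β S.τ S.s
  have hτ := neg_one_lt_of_mem_Delta hΔ
  have hτ1 : 0 ≤ 1 - S.τ := by have := hΔ.2.1; simp only at this; linarith
  refine ⟨fun ω => C * (‖act P.B (Z.y κ ω - ys)‖ ^ 2 + (2 * ‖Z.lam κ ω‖ ^ 2 + 2 * ρ ^ 2))
    + 1 / 2 * sqNormW S.L (Z.y κ ω - ys)
    + 1 / 2 * (R * ‖Z.x κ ω - xs‖ ^ 2)
    + S.β / 2 * ((1 - S.s) ^ 2 / (1 + S.τ)) * ‖P.resid (Z.x κ ω) (Z.y κ ω)‖ ^ 2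
    + (1 - S.τ) / (1 + S.τ) / 2 * (2 * sqNormW S.L (Z.y κ ω - ys)
      + 2 * sqNormW S.L (Z.y (κ - 1) ω - ys)), ?_, fun ω l hl => ?_⟩
  · have a1 := integrable_norm_sq_of_memLp h1.By
    have a2 := integrable_norm_sq_of_memLp h1.lam
    have a3 := integrable_norm_sq_of_memLp (h1.x.sub (memLp_const xs))
    have a4 := integrable_norm_sq_of_memLp (h1.resid hr h1.x)
    exact (((((a1.add ((a2.const_mul 2).add (integrable_const _))).const_mul C).add
      (h1.Ly.const_mul _)).add ((a3.const_mul R).const_mul _)).add (a4.const_mul _)).add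
      (((h1.Ly.const_mul 2).add (h0.Ly.const_mul 2)).const_mul _)
  · have b1 := hV (act P.B (Z.y κ ω - ys)) (Z.lam κ ω - l)
    have b2 : ‖Z.lam κ ω - l‖ ^ 2 ≤ 2 * ‖Z.lam κ ω‖ ^ 2 + 2 * ρ ^ 2 := by
      have h := norm_sub_le (Z.lam κ ω) l
      have h' : ‖Z.lam κ ω - l‖ ≤ ‖Z.lam κ ω‖ + ρ := by linarith
      have := pow_le_pow_left₀ (norm_nonneg _) h' 2
      nlinarith [sq_nonneg (‖Z.lam κ ω‖ - ρ)]
    have b3 := sqNormW_D_le (P := P) hβ (hM ω) (Z.x κ ω - xs)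
    have b4 : sqNormW S.L (Z.y κ ω - Z.y (κ - 1) ω)
        ≤ 2 * sqNormW S.L (Z.y κ ω - ys) + 2 * sqNormW S.L (Z.y (κ - 1) ω - ys) := by
      have e : Z.y κ ω - Z.y (κ - 1) ω = (Z.y κ ω - ys) - (Z.y (κ - 1) ω - ys) := by abel
      have h := sqNormW_nonneg hL ((Z.y κ ω - ys) + (Z.y (κ - 1) ω - ys))
      rw [sqNormW_add hL.isHermitian] at h
      rw [e, sqNormW_sub hL.isHermitian]
      linarith
    unfold potential
    have b5 : C * (‖act P.B (Z.y κ ω - ys)‖ ^ 2 + ‖Z.lam κ ω - l‖ ^ 2)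
        ≤ C * (‖act P.B (Z.y κ ω - ys)‖ ^ 2 + (2 * ‖Z.lam κ ω‖ ^ 2 + 2 * ρ ^ 2)) := by gcongr
    have b6 := mul_le_mul_of_nonneg_left b4 (by positivity : 0 ≤ (1 - S.τ) / (1 + S.τ) / 2)
    linarith

theorem IsRun.measurable_resid_erg (hR : Z.IsRun P S μ 𝓖) (κ T : ℕ) :
    StronglyMeasurable (fun ω => P.resid (Z.xErg κ T ω) (Z.yErg κ T ω)) := by
  have hx : StronglyMeasurable (Z.xErg κ T) :=
    (Finset.stronglyMeasurable_fun_sum _ fun k _ => hR.x_meas (k + 1)).const_smul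
      (1 / ((T : ℝ) + 1))
  have hy : StronglyMeasurable (Z.yErg κ T) :=
    (Finset.stronglyMeasurable_fun_sum _ fun k _ => hR.y_meas (k + 1)).const_smul
      (1 / ((T : ℝ) + 1))
  exact (((continuous_act P.A).comp_stronglyMeasurable hx).add
    ((continuous_act P.B).comp_stronglyMeasurable hy)).sub stronglyMeasurable_const

theorem IsRun.measurable_objective_erg (hR : Z.IsRun P S μ 𝓖) (hP : P.Standing)
    (hL : S.L.PosSemidef) (κ T : ℕ) :
    Measurable (fun ω => P.f (Z.xErg κ T ω) + P.gReal (Z.yErg κ T ω)) := by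
  have hx : Measurable (Z.xErg κ T) :=
    ((Finset.stronglyMeasurable_fun_sum _ fun k _ => hR.x_meas (k + 1)).const_smul
      (1 / ((T : ℝ) + 1))).measurable
  have hy : Measurable (Z.yErg κ T) :=
    ((Finset.stronglyMeasurable_fun_sum _ fun k _ => hR.y_meas (k + 1)).const_smul
      (1 / ((T : ℝ) + 1))).measurable
  -- f is known to be continuous only at points of X, so measurability is taken on the subtype, in
  -- which the averages live.
  have hf : Measurable (fun x : P.X => P.f x) :=
    (continuousOn_iff_continuous_domRestrict.1 fun x hx =>
      (hP.hasGradientAt_f hx).continuousAt.continuousWithinAt).measurable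
  have h1 : Measurable (fun ω => P.f (Z.xErg κ T ω)) :=
    hf.comp (hx.subtype_mk (h := fun ω => (hR.updates ω).xErg_mem hP (hR.x_zero_mem ω) κ T))
  have h2 : Measurable (fun ω => P.gReal (Z.yErg κ T ω)) :=
    hP.meas_g.ereal_toReal.comp
      (hy.subtype_mk (h := fun ω => ((hR.updates ω).yErg_mem hP hL κ T).1))
  exact h1.add h2

end Trajectory

/-! ### The estimate in expectation and the final rates. -/

/-- The ergodic estimate in expectation: everything is bounded by a constant plus a multiple of
`∑ 1 / m_k`, divided by `T + 1`. -/
theorem Trajectory.IsRun.exists_expectation_le {n n₁ n₂ N : ℕ} {Ω : Type*} [MeasurableSpace Ω]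
    {Z : Trajectory n n₁ n₂ N Ω} {P : Problem n n₁ n₂ N} {S : Params n₁ n₂} {μ : Measure Ω}
    [IsFiniteMeasure μ] {𝓖 : Filtration (ℕ ×ₗ ℕ) (inferInstance : MeasurableSpace Ω)}
    (hR : Z.IsRun P S μ 𝓖) (hP : P.Standing) (hβ : 0 < S.β) (hH : S.H.PosDef)
    (hL : S.L.PosSemidef) (hΔ : (S.τ, S.s) ∈ Delta) {ν : ℝ} (hν : 0 < ν)
    (hLip : P.GradLipschitz S.H ν) {c₁ : ℝ} (hm : ∀ k, 0 < S.m k) (hη0 : ∀ k, 0 < S.η k)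
    (hη₁ : ∀ k, S.η k ≤ c₁ / ((S.m k : ℝ) * ((S.m k : ℝ) + 1))) (hθ : Antitone S.weight)
    {κ : ℕ} (hκ : 0 < κ) (hη : ∀ k ≥ κ, S.η k ≤ 1 / (2 * ν))
    (hD : ∀ k ≥ κ, ∀ ω, (Z.D P S k ω - Z.D P S (k + 1) ω).PosSemidef)
    (hMκ : ∃ R : ℝ, ∀ ω, (R • (1 : Matrix (Fin n₁) (Fin n₁) ℝ) - Z.M κ ω).PosSemidef)
    (hδ : ∀ k, ∀ t ∈ Finset.Icc 1 (S.m k),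
      Integrable (fun ω => sqNormW S.H⁻¹ (Z.δ P k t ω)) μ)
    {σ : ℝ} (hδσ : ∀ k ≥ κ, ∀ t ∈ Finset.Icc 1 (S.m k),
      ∫ ω, sqNormW S.H⁻¹ (Z.δ P k t ω) ∂μ ≤ σ ^ 2)
    {xs : Vec n₁} {ys : Vec n₂} {ls : Vec n} (hw : P.IsSaddlePoint xs ys ls) :
    ∃ K : ℝ, ∀ T : ℕ,
      Integrable (fun ω => P.f (Z.xErg κ T ω) + P.gReal (Z.yErg κ T ω)) μ ∧
      Integrable (fun ω => ‖P.resid (Z.xErg κ T ω) (Z.yErg κ T ω)‖) μ ∧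
      |∫ ω, (P.f (Z.xErg κ T ω) + P.gReal (Z.yErg κ T ω) - (P.f xs + P.gReal ys)) ∂μ|
        ≤ 1 / ((T : ℝ) + 1) * ((‖ls‖ + 1) *
          (K + c₁ * σ ^ 2 * ∑ k ∈ Finset.Icc κ (κ + T), 1 / (S.m k : ℝ))) ∧
      |∫ ω, ‖P.resid (Z.xErg κ T ω) (Z.yErg κ T ω)‖ ∂μ|
        ≤ 1 / ((T : ℝ) + 1) * (K + c₁ * σ ^ 2 * ∑ k ∈ Finset.Icc κ (κ + T), 1 / (S.m k : ℝ)) := by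
  have hsq := hR.sqIntegrable hP hβ hH hL hLip hη0 hδ hw
  obtain ⟨Φ, hΦi, hΦ⟩ := exists_potential_le hβ hL hΔ (hw.resid_eq_zero hP) hMκ (hsq κ)
    (hsq (κ - 1)) (‖ls‖ + 1)
  have hnoise := hR.noise_integral hP hβ hH hL hLip hη0 hδ hw
  have ha : Integrable (fun ω => S.weight κ * sqNormW S.H (Z.xb κ ω - xs)) μ :=
    (integrable_sqNormW ((hsq κ).xb.sub (memLp_const xs))).const_mul _
  have hΦa : Integrable (fun ω => Φ ω + S.weight κ * sqNormW S.H (Z.xb κ ω - xs)) μ := hΦi.add ha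
  refine ⟨∫ ω, (Φ ω + S.weight κ * sqNormW S.H (Z.xb κ ω - xs)) ∂μ, fun T => ?_⟩
  have hs : Integrable (fun ω => ∑ k ∈ Finset.Icc κ (κ + T), Z.noise P S xs k ω) μ :=
    integrable_finsetSum _ fun k _ => (hnoise k).1
  set W : Ω → ℝ := fun ω => 1 / ((T : ℝ) + 1) * (Φ ω + S.weight κ * sqNormW S.H (Z.xb κ ω - xs)
    + ∑ k ∈ Finset.Icc κ (κ + T), Z.noise P S xs k ω) with hW
  have hWi : Integrable W μ := (hΦa.add hs).const_mul _
  have hpath := fun ω => (hR.updates ω).ergodic_le hP (hR.x_zero_mem ω) hβ hH hL hΔ hν hLip hm hη0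
    hθ hκ hη (fun k hk => hD k hk ω) hw (hΦ ω) T
  have hWint : ∫ ω, W ω ∂μ ≤ 1 / ((T : ℝ) + 1)
      * (∫ ω, (Φ ω + S.weight κ * sqNormW S.H (Z.xb κ ω - xs)) ∂μ
        + c₁ * σ ^ 2 * ∑ k ∈ Finset.Icc κ (κ + T), 1 / (S.m k : ℝ)) := by
    rw [hW, integral_const_mul, integral_add hΦa hs, integral_finsetSum _ fun k _ => (hnoise k).1,
      Finset.mul_sum]
    gcongr with k hk
    rw [(hnoise k).2]
    exact sum_noise_bound (hm k) (hη0 k) (hη₁ k) (hδσ k (Finset.mem_Icc.1 hk).1)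
  have hgap : Integrable (fun ω => P.f (Z.xErg κ T ω) + P.gReal (Z.yErg κ T ω)
      - (P.f xs + P.gReal ys)) μ :=
    (hWi.const_mul (‖ls‖ + 1)).mono'
      ((hR.measurable_objective_erg hP hL κ T).sub_const _).aestronglyMeasurable
      (Eventually.of_forall fun ω => (hpath ω).2)
  have hres : Integrable (fun ω => ‖P.resid (Z.xErg κ T ω) (Z.yErg κ T ω)‖) μ :=
    hWi.mono' (hR.measurable_resid_erg κ T).norm.aestronglyMeasurable
      (Eventually.of_forall fun ω => by rw [norm_norm]; exact (hpath ω).1)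
  refine ⟨?_, hres, ?_, ?_⟩
  · have := hgap.add (integrable_const (P.f xs + P.gReal ys))
    exact this.congr (Eventually.of_forall fun ω => by simp)
  · calc _ ≤ ∫ ω, |P.f (Z.xErg κ T ω) + P.gReal (Z.yErg κ T ω) - (P.f xs + P.gReal ys)| ∂μ :=
          abs_integral_le_integral_abs
      _ ≤ ∫ ω, (‖ls‖ + 1) * W ω ∂μ :=
          integral_mono hgap.abs (hWi.const_mul _) fun ω => (hpath ω).2
      _ = (‖ls‖ + 1) * ∫ ω, W ω ∂μ := integral_const_mul _ _
      _ ≤ _ := (mul_le_mul_of_nonneg_left hWint (by positivity)).trans_eq (by ring)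
  · rw [abs_of_nonneg (integral_nonneg fun ω => norm_nonneg _)]
    exact (integral_mono hres hWi fun ω => (hpath ω).1).trans hWint

end SASADMM

theorem mainTheorem1 {n n₁ n₂ N : ℕ} {Ω : Type*} [MeasurableSpace Ω]
    (μ : Measure Ω) [IsProbabilityMeasure μ]
    (𝓖 : Filtration (ℕ ×ₗ ℕ) (inferInstance : MeasurableSpace Ω))
    (P : SASADMM.Problem n n₁ n₂ N) (S : SASADMM.Params n₁ n₂)
    (Z : SASADMM.Trajectory n n₁ n₂ N Ω)
    (hP : P.Standing)
    (hβ : 0 < S.β) (hH : S.H.PosDef) (hL : S.L.PosSemidef)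
    (hΔ : (S.τ, S.s) ∈ SASADMM.Delta)
    (ν : ℝ) (hν : 0 < ν) (hLip : P.GradLipschitz S.H ν)
    -- the choice of the inner iteration counts and inner stepsizes
    (c₁ c₂ c₃ ϱ : ℝ) (m : ℕ) (hc₁ : 0 < c₁) (hc₂ : 0 < c₂) (hc₃ : 0 < c₃)
    (hϱ : 1 ≤ ϱ) (hm : 0 < m)
    (hmk : ∀ k : ℕ, S.m k = max ⌈c₃ * (k : ℝ) ^ ϱ⌉₊ m)
    (hηk : ∀ k : ℕ, S.η k = min (c₁ / ((S.m k : ℝ) * ((S.m k : ℝ) + 1))) c₂)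
    (hRun : Z.IsRun P S μ 𝓖)
    -- the conditions on the iterations `k ≥ κ`
    (κ : ℕ) (hκ : 0 < κ)
    (hη : ∀ k ≥ κ, S.η k ≤ 1 / (2 * ν))
    (hD : ∀ k ≥ κ, ∀ ω, (Z.D P S k ω - Z.D P S (k + 1) ω).PosSemidef)
    (hMκ : ∃ R : ℝ, ∀ ω, (R • (1 : Matrix (Fin n₁) (Fin n₁) ℝ) - Z.M κ ω).PosSemidef)
    (hδ : ∀ k, ∀ t ∈ Finset.Icc 1 (S.m k),
      Integrable (fun ω => SASADMM.sqNormW S.H⁻¹ (Z.δ P k t ω)) μ)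
    (σ : ℝ) (hσ : 0 < σ)
    (hδσ : ∀ k ≥ κ, ∀ t ∈ Finset.Icc 1 (S.m k),
      ∫ ω, SASADMM.sqNormW S.H⁻¹ (Z.δ P k t ω) ∂μ ≤ σ ^ 2)
    -- a saddle point
    (xs : SASADMM.Vec n₁) (ys : SASADMM.Vec n₂) (ls : SASADMM.Vec n)
    (hw : P.IsSaddlePoint xs ys ls) :
    -- all objective values are finite and all expectations exist
    P.F xs ys ≠ ⊤ ∧
    (∀ T ω, P.F (Z.xErg κ T ω) (Z.yErg κ T ω) ≠ ⊤) ∧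
    (∀ T, Integrable (fun ω => (P.F (Z.xErg κ T ω) (Z.yErg κ T ω)).toReal) μ) ∧
    (∀ T, Integrable (fun ω => ‖P.resid (Z.xErg κ T ω) (Z.yErg κ T ω)‖) μ) ∧
    -- the rates
    (1 < ϱ →
      (fun T : ℕ =>
        |∫ ω, ((P.F (Z.xErg κ T ω) (Z.yErg κ T ω)).toReal - (P.F xs ys).toReal) ∂μ|)
          =O[atTop] (fun T : ℕ => 1 / (T : ℝ)) ∧
      (fun T : ℕ => ∫ ω, ‖P.resid (Z.xErg κ T ω) (Z.yErg κ T ω)‖ ∂μ)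
          =O[atTop] (fun T : ℕ => 1 / (T : ℝ))) ∧
    (ϱ = 1 →
      (fun T : ℕ =>
        |∫ ω, ((P.F (Z.xErg κ T ω) (Z.yErg κ T ω)).toReal - (P.F xs ys).toReal) ∂μ|)
          =O[atTop] (fun T : ℕ => Real.log (T : ℝ) / (T : ℝ)) ∧
      (fun T : ℕ => ∫ ω, ‖P.resid (Z.xErg κ T ω) (Z.yErg κ T ω)‖ ∂μ)
          =O[atTop] (fun T : ℕ => Real.log (T : ℝ) / (T : ℝ))) := by
  have hmpos : ∀ k, 0 < S.m k := fun k => by rw [hmk]; exact lt_max_of_lt_right hm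
  have hη0 : ∀ k, 0 < S.η k := fun k => by
    have : (0 : ℝ) < S.m k := by exact_mod_cast hmpos k
    rw [hηk]; exact lt_min (by positivity) hc₂
  have hη₁ : ∀ k, S.η k ≤ c₁ / ((S.m k : ℝ) * ((S.m k : ℝ) + 1)) := fun k => by
    rw [hηk]; exact min_le_left _ _
  have hθ := SASADMM.Params.weight_antitone hc₁ hc₂ hmpos (SASADMM.Params.m_mono hc₃ hϱ hmk) hηk
  obtain ⟨K, hK⟩ := hRun.exists_expectation_le hP hβ hH hL hΔ hν hLip hmpos hη0 hη₁ hθ hκ hη hD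
    hMκ hδ hδσ hw
  have hys := hw.mem_dom hP
  have hmem := fun T ω => (hRun.updates ω).yErg_mem hP hL κ T
  have hF : ∀ T ω, P.F (Z.xErg κ T ω) (Z.yErg κ T ω)
      = ((P.f (Z.xErg κ T ω) + P.gReal (Z.yErg κ T ω) : ℝ) : EReal) := fun T ω =>
    hP.F_eq _ (hmem T ω)
  have hFs := hP.F_eq xs hys
  simp only [hF, hFs, EReal.toReal_coe]
  have hsum : ∀ T : ℕ, ∑ k ∈ Finset.Icc κ (κ + T), 1 / (S.m k : ℝ)
      ≤ 1 / c₃ * ∑ k ∈ Finset.Icc κ (κ + T), 1 / (k : ℝ) ^ ϱ := fun T => by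
    rw [Finset.mul_sum]
    exact Finset.sum_le_sum fun k hk =>
      SASADMM.Params.one_div_m_le hc₃ hmk (hκ.trans_le (Finset.mem_Icc.1 hk).1)
  refine ⟨EReal.coe_ne_top _, fun T ω => EReal.coe_ne_top _, fun T => (hK T).1,
    fun T => (hK T).2.1, fun hϱ1 => ?_, fun hϱ1 => ?_⟩
  · have hsummable := Real.summable_one_div_nat_rpow.2 hϱ1
    have hbd : ∀ T : ℕ, K + c₁ * σ ^ 2 * ∑ k ∈ Finset.Icc κ (κ + T), 1 / (S.m k : ℝ)
        ≤ K + c₁ * σ ^ 2 * (1 / c₃ * ∑' k : ℕ, 1 / (k : ℝ) ^ ϱ) := fun T => by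
      gcongr
      refine (hsum T).trans ?_
      gcongr
      exact hsummable.sum_le_tsum _ fun k _ => by positivity
    constructor
    · refine SASADMM.isBigO_one_div_of_le (K := (‖ls‖ + 1)
        * (K + c₁ * σ ^ 2 * (1 / c₃ * ∑' k : ℕ, 1 / (k : ℝ) ^ ϱ))) fun T => ?_
      rw [abs_abs]
      refine (hK T).2.2.1.trans ?_
      gcongr ?_ * (?_ * ?_)
      exact hbd T
    · refine SASADMM.isBigO_one_div_of_le
        (K := K + c₁ * σ ^ 2 * (1 / c₃ * ∑' k : ℕ, 1 / (k : ℝ) ^ ϱ)) fun T => (hK T).2.2.2.trans ?_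
      gcongr ?_ * ?_
      exact hbd T
  · subst hϱ1
    simp only [Real.rpow_one] at hsum
    -- No sign of K is recorded, so |K| provides the nonnegative constant that
    -- `isBigO_log_div_of_le` asks for.
    have hbd : ∀ T : ℕ, 1 ≤ T → K + c₁ * σ ^ 2 * ∑ k ∈ Finset.Icc κ (κ + T), 1 / (S.m k : ℝ)
        ≤ (|K| + c₁ * σ ^ 2 * (1 / c₃ * (1 + Real.log (κ + 1))))
          + c₁ * σ ^ 2 * (1 / c₃) * Real.log T := fun T hT => by
      have h1 := (hsum T).trans (mul_le_mul_of_nonneg_left (SASADMM.sum_one_div_le_log hκ hT)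
        (by positivity))
      have h2 := mul_le_mul_of_nonneg_left h1 (by positivity : 0 ≤ c₁ * σ ^ 2)
      have h3 := le_abs_self K
      linarith
    have hlog : 0 ≤ Real.log ((κ : ℝ) + 1) := Real.log_nonneg (by
      have : (0 : ℝ) ≤ κ := by positivity
      linarith)
    constructor
    · refine SASADMM.isBigO_log_div_of_le
        (K₁ := (‖ls‖ + 1) * (|K| + c₁ * σ ^ 2 * (1 / c₃ * (1 + Real.log (κ + 1)))))
        (K₂ := (‖ls‖ + 1) * (c₁ * σ ^ 2 * (1 / c₃))) (by positivity) (by positivity)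
        fun T hT => ?_
      rw [abs_abs]
      refine (hK T).2.2.1.trans ?_
      rw [mul_assoc (‖ls‖ + 1) (c₁ * σ ^ 2 * (1 / c₃)), ← mul_add]
      gcongr ?_ * (?_ * ?_)
      exact hbd T hT
    · refine SASADMM.isBigO_log_div_of_le
        (K₁ := |K| + c₁ * σ ^ 2 * (1 / c₃ * (1 + Real.log (κ + 1))))
        (K₂ := c₁ * σ ^ 2 * (1 / c₃)) (by positivity) (by positivity)
        fun T hT => (hK T).2.2.2.trans ?_
      gcongr ?_ * ?_
      exact hbd T hT
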